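/- **Corollary (Approximate Factorization).** Let $\mathcal A$ be a finite alphabet and let $\Omega=\mathcal A^{\mathbb N}$ be the one-sided shift space with the $\sigma$-field generated by the cylinder sets $[u]:=\{y\in\Omega: y_1^{n}=u\}$, $u\in\mathcal A^n$, $n\ge 1$, where $y_1^n:=(y_1,\dots,y_n)$. Let $\mathbb P$ be a probability measure on $\Omega$ that is invariant under the left shift $(Tx)_k=x_{k+1}$. For every $N\ge 1$ and $x\in\Omega$ let $$x_1^N=w_1^{(N)}(x)\,w_2^{(N)}(x)\cdots w_{c_N(x)}^{(N)}(x)$$ be a parsing, that is, a decomposition of $x_1^N$ into $c_N(x)\le N$ contiguous nonempty blocks, where the number of blocks $c_N$ and the blocks $w_i^{(N)}$ (defined on $\{i\le c_N\}$) are measurable functions of $x$ and otherwise arbitrary. Assume that $$\lim_{N\to\infty}\frac{c_N(x)}{N}=0\qquad\text{for }\mathbb P\text{-almost every }x.$$ Then there exists a sequence of measurable functions $r_N:\Omega\to\mathbb R$ with $r_N\in L^1(\mathbb P)$ and $r_N/N\to 0$ both $\mathbb P$-almost surely and in $L^1(\mathbb P)$, such that for every $N\ge 1$ and every $x\in\Omega$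 with $\mathbb P([x_1^N])>0$, $$\mathbb P([x_1^N])=\Bigg(\prod_{i=1}^{c_N(x)}\mathbb P\big([w_i^{(N)}(x)]\big)\Bigg)\exp\{r_N(x)\}.$$ In particular, for $\mathbb P$-almost every $x$, this identity holds for all $N\ge 1$ simultaneously. -/

import Mathlib

open MeasureTheory Filter Topology

namespace ShiftSpace

/-- The word `x_1^N = (x_1, …, x_N)`; the coordinates of `x : ℕ → A` are indexed from `0`. -/
def prefixWord {A : Type*} (x : ℕ → A) (N : ℕ) : List A :=
  (List.range N).map x

/-- The cylinder `[u]` of all sequences that start with the finite word `u`. -/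
def cyl {A : Type*} (u : List A) : Set (ℕ → A) :=
  {y | prefixWord y u.length = u}

/-- The left shift `(T x)_k = x_{k+1}`. -/
def shift {A : Type*} (x : ℕ → A) : ℕ → A :=
  fun k => x (k + 1)

/-- A (data-dependent) parsing of the words `x_1^N`, `N ≥ 1`, into `c N x` contiguous nonempty
blocks. The `i`-th block, with `i` counted from `0`, is `block N i x`; its value is meaningful only
for `i < c N x`. Nothing relates the parsings for different `N`. -/
structure Parsing (A : Type*) [MeasurableSpace A] where
  /-- the number of blocks -/
  c : ℕ → (ℕ → A) → ℕ
  /-- the blocks -/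
  block : ℕ → ℕ → (ℕ → A) → List A
  /-- the number of blocks is a random variable -/
  measurable_c : ∀ N, 1 ≤ N → Measurable (c N)
  /-- the `i`-th block is a random variable (with values in the countable set of finite words)
  on the event that there is an `i`-th block -/
  measurableSet_block : ∀ N, 1 ≤ N → ∀ (i : ℕ) (u : List A),
    MeasurableSet {x | i < c N x ∧ block N i x = u}
  /-- there are at most `N` blocks -/
  c_le : ∀ N, 1 ≤ N → ∀ x, c N x ≤ N
  /-- the blocks have length at least `1` -/
  one_le_length : ∀ N, 1 ≤ N → ∀ x, ∀ i < c N x, 1 ≤ (block N i x).length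
  /-- the blocks have length at most `N` -/
  length_le : ∀ N, 1 ≤ N → ∀ x, ∀ i < c N x, (block N i x).length ≤ N
  /-- the concatenation of the blocks is `x_1^N` -/
  flatten_eq : ∀ N, 1 ≤ N → ∀ x,
    ((List.range (c N x)).map (fun i => block N i x)).flatten = prefixWord x N

end ShiftSpace

/-! Take r_N = log P[x_1^N] - Σ log P[w_i]. By invariance every block of a word of positive
probability has positive probability, so the factorization is immediate. The content is a pair of
bounds on r_N, holding almost surely for all N and all parsings at once, with error εN + B · (number
of blocks) plus a term controlled in mean.

Bound from below (`exists_sum_log_sub_log_le`): cut at random, with probability 1 - γ at each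
position, and fill the pieces with independent P-distributed words. This mixes all parsings into one
subprobability Q, to which a parsing into c blocks contributes at least (1-γ)^c γ^N ∏ P[w_i]. Since
Q/P has P-integral at most 1, a factor γ^N makes these ratios summable in mean.

Bound from above (`exists_log_sub_sum_log_le`): compare each block with a k-step Markov measure M
running backwards in time. Conditioning on later letters keeps all information functions on the
one-sided shift space. Again M/P has integral at most 1; a sum over block lengths with exponential
discount gives a function of the starting point alone, of small integral. The conditional
informations of the blocks then fit into the chain rule for the whole word, up to `infoGap`. Its
integral vanishes as k grows, by bounded martingale convergence and the integrability of the
supremum of the informations (Chung–Neveu). The error is an ergodic sum of some H with ∫ H ≤ ε.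

For almost sure convergence, the maximal ergodic inequality bounds these sums linearly off a set of
small measure; neither ergodicity nor the ergodic theorem is needed. Integrating the same bounds
gives convergence in L¹. -/

namespace ShiftSpace

open scoped ENNReal

set_option linter.unusedSectionVars false

/-! ### Finite words and sums over words of fixed length -/

section Words

variable {A : Type*}

@[simp] theorem prefixWord_zero (x : ℕ → A) : prefixWord x 0 = [] := rfl

@[simp] theorem length_prefixWord (x : ℕ → A) (n : ℕ) : (prefixWord x n).length = n := by
  simp [prefixWord]

theorem prefixWord_succ (x : ℕ → A) (n : ℕ) :
    prefixWord x (n + 1) = prefixWord x n ++ [x n] := by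
  simp [prefixWord, List.range_succ]

theorem prefixWord_succ_cons (x : ℕ → A) (n : ℕ) :
    prefixWord x (n + 1) = x 0 :: prefixWord (shift x) n := by
  simp [prefixWord, List.range_succ_eq_map, shift, Function.comp_def]

theorem prefixWord_add (x : ℕ → A) (m n : ℕ) :
    prefixWord x (m + n) = prefixWord x m ++ prefixWord (shift^[m] x) n := by
  induction m generalizing x with
  | zero => simp
  | succ m ih =>
    rw [Nat.add_right_comm, prefixWord_succ_cons, ih, prefixWord_succ_cons]
    rfl

theorem take_prefixWord (x : ℕ → A) {m n : ℕ} (h : m ≤ n) :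
    (prefixWord x n).take m = prefixWord x m := by
  obtain ⟨d, rfl⟩ := Nat.exists_eq_add_of_le h
  rw [prefixWord_add, List.take_left' (by simp)]

theorem mem_cyl {u : List A} {x : ℕ → A} : x ∈ cyl u ↔ prefixWord x u.length = u := Iff.rfl

theorem mem_cyl_prefixWord (x : ℕ → A) (n : ℕ) : x ∈ cyl (prefixWord x n) := by
  simp [mem_cyl]

@[simp] theorem cyl_nil : cyl ([] : List A) = Set.univ := by
  ext x; simp [mem_cyl]

theorem mem_cyl_concat {u : List A} {a : A} {x : ℕ → A} :
    x ∈ cyl (u ++ [a]) ↔ x ∈ cyl u ∧ x u.length = a := by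
  simp [mem_cyl, prefixWord_succ]

theorem mem_cyl_cons {u : List A} {a : A} {x : ℕ → A} :
    x ∈ cyl (a :: u) ↔ x 0 = a ∧ shift x ∈ cyl u := by
  simp [mem_cyl, prefixWord_succ_cons]

/-- The sum of `φ` over the words of length `n`. -/
noncomputable def wordSum [Fintype A] : ℕ → (List A → ℝ≥0∞) → ℝ≥0∞
  | 0, φ => φ []
  | n + 1, φ => ∑ a, wordSum n (fun u => φ (a :: u))

variable [Fintype A]

theorem wordSum_mono {n : ℕ} {φ ψ : List A → ℝ≥0∞} (h : ∀ u, φ u ≤ ψ u) :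
    wordSum n φ ≤ wordSum n ψ := by
  induction n generalizing φ ψ with
  | zero => exact h _
  | succ n ih => exact Finset.sum_le_sum fun a _ => ih fun u => h _

theorem wordSum_add (n : ℕ) (φ ψ : List A → ℝ≥0∞) :
    wordSum n (fun u => φ u + ψ u) = wordSum n φ + wordSum n ψ := by
  induction n generalizing φ ψ with
  | zero => rfl
  | succ n ih => simp only [wordSum, ih, Finset.sum_add_distrib]

theorem wordSum_mul_left (n : ℕ) (c : ℝ≥0∞) (φ : List A → ℝ≥0∞) :
    wordSum n (fun u => c * φ u) = c * wordSum n φ := by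
  induction n generalizing φ with
  | zero => rfl
  | succ n ih => simp only [wordSum, ih, Finset.mul_sum]

theorem wordSum_sum {ι : Type*} (s : Finset ι) (n : ℕ) (φ : ι → List A → ℝ≥0∞) :
    wordSum n (fun u => ∑ i ∈ s, φ i u) = ∑ i ∈ s, wordSum n (φ i) := by
  induction n generalizing φ with
  | zero => rfl
  | succ n ih => simp only [wordSum, ih]; exact Finset.sum_comm

theorem wordSum_succ_concat (n : ℕ) (φ : List A → ℝ≥0∞) :
    wordSum (n + 1) φ = wordSum n (fun u => ∑ a, φ (u ++ [a])) := by
  induction n generalizing φ with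
  | zero => rfl
  | succ n ih =>
    exact Finset.sum_congr rfl fun a _ => ih _

end Words

/-! ### Cylinder sets, their measures, and integrals of functions of a prefix -/

section Cylinders

variable {A : Type*} [MeasurableSpace A] [MeasurableSingletonClass A]

theorem measurableSet_cyl (u : List A) : MeasurableSet (cyl u) := by
  induction u using List.reverseRecOn with
  | nil => simp
  | append_singleton u a ih =>
    have : cyl (u ++ [a]) = cyl u ∩ (fun x : ℕ → A => x u.length) ⁻¹' {a} := by
      ext x; simp [mem_cyl_concat]
    rw [this]
    exact ih.inter ((measurable_pi_apply _) (measurableSet_singleton a))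

theorem measurable_shift : Measurable (shift : (ℕ → A) → ℕ → A) :=
  measurable_pi_lambda _ fun k => measurable_pi_apply (k + 1)

variable [Finite A]

theorem measurable_comp_prefixWord {β : Type*} [MeasurableSpace β] (φ : List A → β) (n : ℕ) :
    Measurable fun x : ℕ → A => φ (prefixWord x n) := by
  let : MeasurableSpace (List A) := ⊤
  have : Countable A := Finite.to_countable
  have h : Measurable fun x : ℕ → A => prefixWord x n := by
    refine measurable_to_countable' fun u => ?_
    by_cases hu : u.length = n
    · subst hu
      exact measurableSet_cyl u
    · convert MeasurableSet.empty
      ext x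
      simp only [Set.mem_preimage, Set.mem_singleton_iff, Set.mem_empty_iff_false, iff_false]
      rintro rfl
      simp at hu
  exact measurable_from_top.comp h

variable (P : Measure (ℕ → A))

theorem measure_cyl_append_le (u v : List A) : P (cyl (u ++ v)) ≤ P (cyl u) := by
  refine measure_mono fun x hx => ?_
  rw [mem_cyl] at hx ⊢
  rw [List.length_append, prefixWord_add] at hx
  exact (List.append_inj hx (by simp)).1

theorem sum_measure_cyl_concat [Fintype A] (u : List A) :
    ∑ a, P (cyl (u ++ [a])) = P (cyl u) := by
  rw [← tsum_fintype (L := .unconditional _), ← measure_iUnion]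
  · congr 1
    ext x
    simp [mem_cyl_concat]
  · intro a b hab
    refine Set.disjoint_left.2 fun x hx hy => hab ?_
    rw [mem_cyl_concat] at hx hy
    exact hx.2.symm.trans hy.2
  · exact fun a => measurableSet_cyl _

theorem setLIntegral_cyl_prefixWord [Fintype A] (φ : List A → ℝ≥0∞) (n : ℕ) (v : List A) :
    ∫⁻ x in cyl v, φ (prefixWord x (v.length + n)) ∂P =
      wordSum n (fun u => φ (v ++ u) * P (cyl (v ++ u))) := by
  induction n generalizing v with
  | zero =>
    rw [setLIntegral_congr_fun (g := fun _ => φ v) (measurableSet_cyl v)]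
    · simp [wordSum]
    · intro x hx
      simp only [Nat.add_zero]
      rw [mem_cyl.1 hx]
  | succ n ih =>
    have hU : cyl v = ⋃ a, cyl (v ++ [a]) := by
      ext x
      simp [mem_cyl_concat]
    rw [hU, lintegral_iUnion (fun a => measurableSet_cyl _), tsum_fintype, wordSum]
    · refine Finset.sum_congr rfl fun a _ => ?_
      have := ih (v ++ [a])
      simp only [List.length_append, List.length_singleton, List.append_assoc,
        List.singleton_append] at this
      rw [← this, add_assoc, add_comm 1 n]
    · intro a b hab
      refine Set.disjoint_left.2 fun x hx hy => hab ?_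
      rw [mem_cyl_concat] at hx hy
      exact hx.2.symm.trans hy.2

theorem lintegral_prefixWord [Fintype A] (φ : List A → ℝ≥0∞) (n : ℕ) :
    ∫⁻ x, φ (prefixWord x n) ∂P = wordSum n (fun u => φ u * P (cyl u)) := by
  simpa using setLIntegral_cyl_prefixWord P φ n []

/-- A likelihood ratio against P has mean at most the mass of its numerator. Equality can fail
because words with P [u] = 0 drop out of the integral. Both bounds on the log-ratio rest on this. -/
theorem lintegral_ratio_le [Fintype A] (Q : List A → ℝ≥0∞) (n : ℕ) :
    ∫⁻ x, Q (prefixWord x n) / P (cyl (prefixWord x n)) ∂P ≤ wordSum n Q := by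
  rw [lintegral_prefixWord P (fun u => Q u / P (cyl u))]
  exact wordSum_mono fun u => (mul_comm _ _).trans_le ENNReal.mul_div_le

theorem ae_measure_cyl_prefixWord_ne_zero : ∀ᵐ x ∂P, ∀ n, P (cyl (prefixWord x n)) ≠ 0 := by
  have : Countable A := Finite.to_countable
  have h : ∀ u : List A, ∀ᵐ x ∂P, P (cyl u) = 0 → x ∉ cyl u := by
    intro u
    by_cases hu : P (cyl u) = 0
    · have : ∀ᵐ x ∂P, x ∉ cyl u := measure_eq_zero_iff_ae_notMem.1 hu
      filter_upwards [this] with x hx _ using hx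
    · simp [hu]
  filter_upwards [ae_all_iff.2 h] with x hx n h0
  exact hx _ h0 (mem_cyl_prefixWord x n)

variable {P}

theorem measure_preimage_shift_cyl (hP : MeasurePreserving shift P P) (u : List A) : P (shift ⁻¹' cyl u) = P (cyl u) :=
  hP.measure_preimage (measurableSet_cyl u).nullMeasurableSet

theorem measure_cyl_cons_le (hP : MeasurePreserving shift P P) (a : A) (u : List A) : P (cyl (a :: u)) ≤ P (cyl u) := by
  rw [← measure_preimage_shift_cyl hP u]
  exact measure_mono fun x hx => (mem_cyl_cons.1 hx).2

theorem measure_cyl_append_le_right (hP : MeasurePreserving shift P P) (u v : List A) : P (cyl (u ++ v)) ≤ P (cyl v) := by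
  induction u with
  | nil => rfl
  | cons a u ih => exact (measure_cyl_cons_le hP a _).trans ih

theorem sum_measure_cyl_cons [Fintype A] (hP : MeasurePreserving shift P P) (u : List A) :
    ∑ a, P (cyl (a :: u)) = P (cyl u) := by
  rw [← measure_preimage_shift_cyl hP u, ← tsum_fintype (L := .unconditional _), ← measure_iUnion]
  · congr 1
    ext x
    simp [mem_cyl_cons]
  · intro a b hab
    refine Set.disjoint_left.2 fun x hx hy => hab ?_
    rw [mem_cyl_cons] at hx hy
    exact hx.1.symm.trans hy.1
  · exact fun a => measurableSet_cyl _

end Cylinders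

/-! ### Maximal ergodic inequality for nonnegative functions -/

section MaximalInequality

/-- Greedy covering: walk through the indices, skipping one where e vanishes and otherwise jumping
over a window of length N ≤ M on which h averages at least l. The last window may overshoot K, which
is why the right-hand sum runs to K + M. -/
theorem mul_sum_le_sum_of_covering {l : ℝ≥0∞} {e h : ℕ → ℝ≥0∞} {M : ℕ} (he : ∀ i, e i ≤ 1)
    (H : ∀ i, e i = 0 ∨ ∃ N, 1 ≤ N ∧ N ≤ M ∧ l * N ≤ ∑ j ∈ Finset.range N, h (i + j)) (K a : ℕ) :
    l * ∑ i ∈ Finset.range K, e (a + i) ≤ ∑ j ∈ Finset.range (K + M), h (a + j) := by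
  induction K using Nat.strong_induction_on generalizing a with
  | _ K ih =>
  rcases Nat.eq_zero_or_pos K with rfl | hK
  · simp
  have key : ∀ N, l * ∑ i ∈ Finset.range N, e (a + i) ≤ l * N := fun N => by
    gcongr
    refine (Finset.sum_le_sum fun i _ => he (a + i)).trans ?_
    simp
  have step : ∀ N, 1 ≤ N → N ≤ K → l * ∑ i ∈ Finset.range N, e (a + i) ≤
      ∑ j ∈ Finset.range N, h (a + j) →
      l * ∑ i ∈ Finset.range K, e (a + i) ≤ ∑ j ∈ Finset.range (K + M), h (a + j) := by
    intro N hN1 hNK hN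
    obtain ⟨d, rfl⟩ := Nat.exists_eq_add_of_le hNK
    rw [Finset.sum_range_add, mul_add, add_assoc, Finset.sum_range_add]
    refine add_le_add hN ?_
    simpa only [add_assoc] using ih d (by omega) (a + N)
  rcases H a with h0 | ⟨N, hN1, hNM, hN⟩
  · refine step 1 le_rfl hK ?_
    simp [h0]
  · rcases le_or_gt N K with hNK | hNK
    · exact step N hN1 hNK ((key N).trans hN)
    · calc l * ∑ i ∈ Finset.range K, e (a + i) ≤ l * K := key K
        _ ≤ l * N := by gcongr
        _ ≤ _ := hN
        _ ≤ _ := Finset.sum_le_sum_of_subset (Finset.range_mono (by omega))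

variable {Ω : Type*} [MeasurableSpace Ω] {μ : Measure Ω} [IsFiniteMeasure μ] {T : Ω → Ω}

/-- Integrate the covering inequality along orbits, with e the indicator of the event. Invariance
makes all terms equal, and after division by K the overshoot M/K disappears as K → ∞. -/
theorem maximal_ergodic_inequality_finite (hT : MeasurePreserving T μ μ) {H : Ω → ℝ≥0∞}
    (hH : Measurable H) (l : ℝ≥0∞) (M : ℕ) :
    l * μ {x | ∃ N, 1 ≤ N ∧ N ≤ M ∧ l * N ≤ ∑ j ∈ Finset.range N, H (T^[j] x)} ≤
      ∫⁻ x, H x ∂μ := by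
  set E := {x | ∃ N, 1 ≤ N ∧ N ≤ M ∧ l * N ≤ ∑ j ∈ Finset.range N, H (T^[j] x)} with hE
  have hTn : ∀ n, MeasurePreserving T^[n] μ μ := fun n => hT.iterate n
  have hEm : MeasurableSet E := by
    have : E = ⋃ N ∈ Set.Icc 1 M, {x | l * N ≤ ∑ j ∈ Finset.range N, H (T^[j] x)} := by
      ext x; simp [hE, and_assoc]
    rw [this]
    refine MeasurableSet.biUnion (Set.to_countable _) fun N _ => ?_
    refine measurableSet_le measurable_const ?_
    exact Finset.measurable_sum _ fun j _ => hH.comp (hTn j).measurable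
  have hint : ∀ K : ℕ, l * (K * μ E) ≤ (K + M : ℕ) * ∫⁻ x, H x ∂μ := by
    intro K
    have hpt : ∀ x, l * ∑ i ∈ Finset.range K, E.indicator 1 (T^[i] x) ≤
        ∑ j ∈ Finset.range (K + M), H (T^[j] x) := by
      intro x
      have := mul_sum_le_sum_of_covering (l := l) (e := fun i => E.indicator 1 (T^[i] x))
        (h := fun j => H (T^[j] x)) (M := M) ?_ ?_ K 0
      · simpa using this
      · intro i
        exact Set.indicator_le' (fun _ _ => le_rfl) (fun _ _ => zero_le) (T^[i] x)
      · intro i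
        by_cases hx : T^[i] x ∈ E
        · right
          obtain ⟨N, h1, h2, h3⟩ := hx
          refine ⟨N, h1, h2, ?_⟩
          simpa only [← Function.iterate_add_apply, add_comm i] using h3
        · left; simp [hx]
    have h1 := lintegral_mono (μ := μ) hpt
    have hm1 : ∀ i, Measurable fun x => E.indicator (1 : Ω → ℝ≥0∞) (T^[i] x) := fun i =>
      (measurable_one.indicator hEm).comp (hTn i).measurable
    have hm2 : ∀ i, Measurable fun x => H (T^[i] x) := fun i => hH.comp (hTn i).measurable
    rw [lintegral_const_mul _ (Finset.measurable_sum _ fun i _ => hm1 i),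
      lintegral_finsetSum _ fun i _ => hm1 i, lintegral_finsetSum _ fun i _ => hm2 i] at h1
    have h2 : ∀ i, ∫⁻ x, E.indicator 1 (T^[i] x) ∂μ = μ E := fun i => by
      rw [(hTn i).lintegral_comp (measurable_one.indicator hEm), lintegral_indicator_one hEm]
    have h3 : ∀ i, ∫⁻ x, H (T^[i] x) ∂μ = ∫⁻ x, H x ∂μ := fun i => (hTn i).lintegral_comp hH
    simp only [h2, h3, Finset.sum_const, Finset.card_range, nsmul_eq_mul] at h1
    exact h1
  by_cases hI : ∫⁻ x, H x ∂μ = ∞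
  · simp [hI]
  have hlim : Tendsto (fun K : ℕ => (1 + (M : ℝ≥0∞) * (K : ℝ≥0∞)⁻¹) * ∫⁻ x, H x ∂μ) atTop
      (𝓝 ((1 + M * 0) * ∫⁻ x, H x ∂μ)) := by
    refine ENNReal.Tendsto.mul_const (tendsto_const_nhds.add ?_) (Or.inr hI)
    exact ENNReal.Tendsto.const_mul ENNReal.tendsto_inv_nat_nhds_zero
      (Or.inr (ENNReal.natCast_ne_top M))
  rw [mul_zero, add_zero, one_mul] at hlim
  refine ge_of_tendsto hlim ?_
  filter_upwards [eventually_ge_atTop 1] with K hK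
  have hK0 : (K : ℝ≥0∞) ≠ 0 := by exact_mod_cast (by omega : K ≠ 0)
  have hKt : (K : ℝ≥0∞) ≠ ∞ := ENNReal.natCast_ne_top K
  rw [← ENNReal.mul_le_mul_iff_right hK0 hKt]
  calc K * (l * μ E) = l * (K * μ E) := by ring
    _ ≤ _ := hint K
    _ = (K + M * (K * (K : ℝ≥0∞)⁻¹)) * ∫⁻ x, H x ∂μ := by
        rw [ENNReal.mul_inv_cancel hK0 hKt]; push_cast; ring
    _ = _ := by ring

/-- The maximal ergodic inequality. -/
theorem maximal_ergodic_inequality (hT : MeasurePreserving T μ μ) {H : Ω → ℝ≥0∞}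
    (hH : Measurable H) (l : ℝ≥0∞) :
    l * μ {x | ∃ N : ℕ, 1 ≤ N ∧ l * N ≤ ∑ j ∈ Finset.range N, H (T^[j] x)} ≤ ∫⁻ x, H x ∂μ := by
  have : {x | ∃ N : ℕ, 1 ≤ N ∧ l * N ≤ ∑ j ∈ Finset.range N, H (T^[j] x)} =
      ⋃ M : ℕ, {x | ∃ N, 1 ≤ N ∧ N ≤ M ∧ l * N ≤ ∑ j ∈ Finset.range N, H (T^[j] x)} := by
    ext x
    simp only [Set.mem_ofPred_eq, Set.mem_iUnion]
    exact ⟨fun ⟨N, h1, h2⟩ => ⟨N, N, h1, le_rfl, h2⟩, fun ⟨_, N, h1, _, h2⟩ => ⟨N, h1, h2⟩⟩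
  rw [this, Monotone.measure_iUnion, ENNReal.mul_iSup]
  · exact iSup_le fun M => maximal_ergodic_inequality_finite hT hH l M
  · intro M M' hM x ⟨N, h1, h2, h3⟩
    exact ⟨N, h1, h2.trans hM, h3⟩

end MaximalInequality

/-! ### Comparison measures: random parsings and backward Markov chains -/

section AuxiliaryMeasures

variable {A : Type*} [MeasurableSpace A] [MeasurableSingletonClass A] [Fintype A]
  (P : Measure (ℕ → A))

/-- The total weight of all parsings of the word `v ++ u` in which no block ends strictly inside
`v`: a parsing has the weight `∏ P [w_i]` times a factor `β` for every cut after `v` and a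
factor `γ` for every position after `v` without a cut. -/
noncomputable def mixture (β γ : ℝ≥0∞) : List A → List A → ℝ≥0∞
  | v, [] => P (cyl v)
  | v, a :: u => γ * mixture β γ (v ++ [a]) u + β * P (cyl v) * mixture β γ [a] u

theorem wordSum_mixture_le [IsProbabilityMeasure P] {β γ : ℝ≥0∞} (h : γ + β ≤ 1) (n : ℕ)
    (v : List A) : wordSum n (mixture P β γ v) ≤ P (cyl v) := by
  induction n generalizing v with
  | zero => exact le_rfl
  | succ n ih =>
    simp only [wordSum, mixture, wordSum_add, wordSum_mul_left]
    calc _ ≤ ∑ a, (γ * P (cyl (v ++ [a])) + β * P (cyl v) * P (cyl ([] ++ [a]))) := by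
          refine Finset.sum_le_sum fun a _ => ?_
          gcongr
          · exact ih _
          · exact ih _
      _ = γ * P (cyl v) + β * P (cyl v) := by
          rw [Finset.sum_add_distrib, ← Finset.mul_sum, ← Finset.mul_sum,
            sum_measure_cyl_concat, sum_measure_cyl_concat]
          simp
      _ ≤ P (cyl v) := by
          rw [← add_mul]
          exact mul_le_of_le_one_left zero_le h

/-- Keep only the parsings without a cut between v and the end of w. -/
theorem pow_mul_mixture_le (β γ : ℝ≥0∞) (v w u : List A) :
    γ ^ w.length * mixture P β γ (v ++ w) u ≤ mixture P β γ v (w ++ u) := by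
  induction w generalizing v with
  | nil => simp
  | cons a w ih =>
    have := ih (v ++ [a])
    rw [List.append_assoc, List.singleton_append] at this
    calc _ = γ * (γ ^ w.length * mixture P β γ (v ++ a :: w) u) := by
          rw [List.length_cons, pow_succ]; ring
      _ ≤ γ * mixture P β γ (v ++ [a]) (w ++ u) := by gcongr
      _ ≤ _ := le_self_add

/-- A single parsing is one term of the mixture. One β is paid at the start of each block, including
a formal cut after the initial v. A block of length n needs only n - 1 factors γ, and the surplus
one is absorbed by γ ≤ 1. -/
theorem le_mixture_flatten {β γ : ℝ≥0∞} (hγ : γ ≤ 1) (ws : List (List A))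
    (hws : ∀ w ∈ ws, w ≠ []) (v : List A) :
    β ^ ws.length * γ ^ ws.flatten.length * (P (cyl v) * (ws.map fun w => P (cyl w)).prod) ≤
      mixture P β γ v ws.flatten := by
  induction ws generalizing v with
  | nil => simp [mixture]
  | cons w ws ih =>
    obtain ⟨a, w', rfl⟩ := List.exists_cons_of_ne_nil (hws w (by simp))
    have h1 := ih (fun w hw => hws w (by simp [hw])) (a :: w')
    have h2 := pow_mul_mixture_le P β γ [a] w' ws.flatten
    rw [List.singleton_append] at h2
    rw [List.flatten_cons, List.cons_append, mixture]
    refine le_trans ?_ (le_add_left le_rfl)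
    calc _ = β * P (cyl v) * (γ ^ w'.length * (γ * (β ^ ws.length * γ ^ ws.flatten.length *
          (P (cyl (a :: w')) * (ws.map fun w => P (cyl w)).prod)))) := by
          simp only [List.length_cons, List.length_append, List.map_cons, List.prod_cons, pow_succ,
            pow_add]
          ring
      _ ≤ β * P (cyl v) * (γ ^ w'.length * (1 * mixture P β γ (a :: w') ws.flatten)) := by
          gcongr
      _ ≤ _ := by
          rw [one_mul]
          gcongr

/-- The probability of a word under the `k`-step Markov approximation of `P` that runs backwards
in time and starts with `k` independent uniformly distributed letters. -/
noncomputable def revMarkov (k : ℕ) : List A → ℝ≥0∞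
  | [] => 1
  | a :: u => (if u.length < k then (Fintype.card A : ℝ≥0∞)⁻¹
      else P (cyl (a :: u.take k)) / P (cyl (u.take k))) * revMarkov k u

/-- Summing out the first letter is the normalization of a transition of the backward chain; here
invariance enters. Only ≤ holds, since conditioning words of measure zero carry no transition mass.
-/
theorem wordSum_revMarkov_le {P : Measure (ℕ → A)} (hP : MeasurePreserving shift P P) (k n : ℕ) :
    wordSum n (revMarkov P k) ≤ 1 := by
  induction n with
  | zero => exact le_rfl
  | succ n ih =>
    refine le_trans ?_ ih
    rw [wordSum, ← wordSum_sum]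
    refine wordSum_mono fun u => ?_
    simp only [revMarkov]
    rw [← Finset.sum_mul]
    refine mul_le_of_le_one_left zero_le ?_
    split_ifs
    · simp [← div_eq_mul_inv]
    · simp only [div_eq_mul_inv]
      rw [← Finset.sum_mul, sum_measure_cyl_cons hP]
      exact ENNReal.mul_inv_le_one _

end AuxiliaryMeasures

/-! ### Conditional information: integrable supremum and almost sure convergence -/

section Information

variable {A : Type*} [MeasurableSpace A] [MeasurableSingletonClass A] [Fintype A]

/-- The conditional information `-log P (x_1 | x_2, …, x_{i+1})`. -/
noncomputable def info (P : Measure (ℕ → A)) (i : ℕ) (x : ℕ → A) : ℝ :=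
  Real.log (P.real (cyl (prefixWord (shift x) i))) - Real.log (P.real (cyl (prefixWord x (i + 1))))

theorem measurable_info (P : Measure (ℕ → A)) (i : ℕ) : Measurable (info P i) :=
  ((measurable_comp_prefixWord (fun u => Real.log (P.real (cyl u))) i).comp measurable_shift).sub
    (measurable_comp_prefixWord (fun u => Real.log (P.real (cyl u))) (i + 1))

/-- The largest excess of the conditional information given `k` letters over that given more letters. -/
noncomputable def infoGap (P : Measure (ℕ → A)) (k : ℕ) (x : ℕ → A) : ℝ≥0∞ :=
  ⨆ i, ENNReal.ofReal (info P k x - info P (k + i) x)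

theorem measurable_infoGap (P : Measure (ℕ → A)) (k : ℕ) : Measurable (infoGap P k) :=
  .iSup fun i => ((measurable_info P k).sub (measurable_info P (k + i))).ennreal_ofReal

variable {P : Measure (ℕ → A)} [IsProbabilityMeasure P]

theorem measureReal_cyl_pos {u : List A} (h : P (cyl u) ≠ 0) : 0 < P.real (cyl u) :=
  ENNReal.toReal_pos h (measure_ne_top _ _)

theorem info_nonneg (hP : MeasurePreserving shift P P) {x : ℕ → A}
    (hx : ∀ n, P (cyl (prefixWord x n)) ≠ 0) (i : ℕ) : 0 ≤ info P i x := by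
  refine sub_nonneg.2 (Real.log_le_log (measureReal_cyl_pos (hx _)) ?_)
  rw [prefixWord_succ_cons]
  exact ENNReal.toReal_mono (measure_ne_top _ _) (measure_cyl_cons_le hP _ _)

/-- Stopping-time argument by recursion on m: where the inequality already holds at v, stop and use
it; otherwise split according to the next letter b, the bounds P [vb] adding up to P [v]. -/
theorem mul_measure_exists_le_le (l : ℝ≥0∞) (m : ℕ) (a : A) (v : List A) :
    l * P {x | x ∈ cyl (a :: v) ∧ ∃ i ≤ m, l * P (cyl (prefixWord x (v.length + i + 1))) ≤
      P (cyl (prefixWord (shift x) (v.length + i)))} ≤ P (cyl v) := by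
  induction m generalizing v with
  | zero =>
    by_cases h : l * P (cyl (a :: v)) ≤ P (cyl v)
    · refine le_trans ?_ h
      gcongr
      exact fun x hx => hx.1
    · refine le_of_eq_of_le ?_ zero_le
      rw [mul_eq_zero]
      right
      refine measure_mono_null ?_ measure_empty
      rintro x ⟨hx, i, hi, hle⟩
      obtain rfl : i = 0 := by omega
      have h2 : prefixWord x (v.length + 0 + 1) = a :: v := hx
      have h3 : prefixWord (shift x) (v.length + 0) = v := (mem_cyl_cons.1 hx).2
      rw [h2, h3] at hle
      exact h hle
  | succ m ih =>
    by_cases h : l * P (cyl (a :: v)) ≤ P (cyl v)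
    · refine le_trans ?_ h
      gcongr
      exact fun x hx => hx.1
    · rw [← sum_measure_cyl_concat P v]
      refine le_trans ?_ (Finset.sum_le_sum fun b _ => ih (v ++ [b]))
      rw [← Finset.mul_sum]
      gcongr
      refine le_trans (measure_mono ?_) (measure_iUnion_fintype_le P _)
      rintro x ⟨hx, i, hi, hle⟩
      have h2 : prefixWord x (v.length + 0 + 1) = a :: v := hx
      have h3 : prefixWord (shift x) (v.length + 0) = v := (mem_cyl_cons.1 hx).2
      rcases i with _ | i
      · rw [h2, h3] at hle
        exact absurd hle h
      · rw [Set.mem_iUnion]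
        refine ⟨shift x v.length, ?_, i, by omega, ?_⟩
        · rw [mem_cyl_cons, mem_cyl_concat]
          exact ⟨(mem_cyl_cons.1 hx).1, (mem_cyl_cons.1 hx).2, rfl⟩
        · rw [List.length_append, List.length_singleton]
          rwa [show v.length + 1 + i = v.length + (i + 1) by omega]

theorem mul_measure_exists_ratio_le (l : ℝ≥0∞) :
    l * P {x | ∃ i, l * P (cyl (prefixWord x (i + 1))) ≤ P (cyl (prefixWord (shift x) i))} ≤
      Fintype.card A := by
  have : {x | ∃ i, l * P (cyl (prefixWord x (i + 1))) ≤ P (cyl (prefixWord (shift x) i))} =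
      ⋃ m : ℕ, {x | ∃ i ≤ m, l * P (cyl (prefixWord x (i + 1))) ≤
        P (cyl (prefixWord (shift x) i))} := by
    ext x
    simp only [Set.mem_ofPred_eq, Set.mem_iUnion]
    exact ⟨fun ⟨i, h⟩ => ⟨i, i, le_rfl, h⟩, fun ⟨_, i, _, h⟩ => ⟨i, h⟩⟩
  rw [this, Monotone.measure_iUnion, ENNReal.mul_iSup]
  · refine iSup_le fun m => ?_
    calc _ ≤ l * ∑ a, P {x | x ∈ cyl (a :: []) ∧ ∃ i ≤ m,
          l * P (cyl (prefixWord x (([] : List A).length + i + 1))) ≤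
            P (cyl (prefixWord (shift x) (([] : List A).length + i)))} := by
          gcongr
          refine le_trans (measure_mono ?_) (measure_iUnion_fintype_le P _)
          rintro x ⟨i, hi, h⟩
          rw [Set.mem_iUnion]
          refine ⟨x 0, ?_, i, hi, ?_⟩
          · simp [mem_cyl_cons]
          · simpa using h
      _ ≤ ∑ a : A, 1 := by
          rw [Finset.mul_sum]
          exact Finset.sum_le_sum fun a _ =>
            (mul_measure_exists_le_le l m a []).trans prob_le_one
      _ = _ := by simp
  · rintro m m' hm x ⟨i, hi, h⟩
    exact ⟨i, hi.trans hm, h⟩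

theorem ofReal_le_tsum_ite (t : ℝ) :
    ENNReal.ofReal t ≤ ∑' n : ℕ, if (n : ℝ) ≤ t then 1 else 0 := by
  rcases lt_or_ge t 0 with h | h
  · simp [ENNReal.ofReal_of_nonpos h.le]
  calc ENNReal.ofReal t ≤ ENNReal.ofReal (⌊t⌋₊ + 1 : ℕ) :=
        ENNReal.ofReal_le_ofReal (by push_cast; exact (Nat.lt_floor_add_one t).le)
    _ = ∑ n ∈ Finset.range (⌊t⌋₊ + 1), 1 := by rw [ENNReal.ofReal_natCast]; simp
    _ = ∑ n ∈ Finset.range (⌊t⌋₊ + 1), if (n : ℝ) ≤ t then 1 else 0 := by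
        refine Finset.sum_congr rfl fun n hn => ?_
        rw [if_pos]
        exact (Nat.le_floor_iff h).1 (by simpa [Nat.lt_succ_iff] using hn)
    _ ≤ _ := ENNReal.sum_le_tsum _

/-- Chung–Neveu: the supremum of the informations reaches n with probability at most |A| e^{-n},
which is summable. -/
theorem lintegral_iSup_info_ne_top (hP : MeasurePreserving shift P P) :
    ∫⁻ x, ⨆ i, ENNReal.ofReal (info P i x) ∂P ≠ ∞ := by
  set E : ℕ → Set (ℕ → A) := fun n => {x | ∃ i, ENNReal.ofReal (Real.exp n) *
    P (cyl (prefixWord x (i + 1))) ≤ P (cyl (prefixWord (shift x) i))} with hE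
  have hEm : ∀ n, MeasurableSet (E n) := by
    intro n
    have : E n = ⋃ i, {x | ENNReal.ofReal (Real.exp n) *
        P (cyl (prefixWord x (i + 1))) ≤ P (cyl (prefixWord (shift x) i))} := by
      ext x; simp [hE]
    rw [this]
    refine MeasurableSet.iUnion fun i => measurableSet_le ?_ ?_
    · exact (measurable_comp_prefixWord (fun u => P (cyl u)) (i + 1)).const_mul _
    · exact (measurable_comp_prefixWord (fun u => P (cyl u)) i).comp measurable_shift
  have hshift := hP.quasiMeasurePreserving.ae (ae_measure_cyl_prefixWord_ne_zero P)
  have hle : ∀ᵐ x ∂P, ⨆ i, ENNReal.ofReal (info P i x) ≤ ∑' n, (E n).indicator 1 x := by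
    filter_upwards [ae_measure_cyl_prefixWord_ne_zero P, hshift] with x hx hx'
    refine iSup_le fun i => (ofReal_le_tsum_ite _).trans (ENNReal.tsum_le_tsum fun n => ?_)
    split_ifs with h
    · rw [Set.indicator_of_mem, Pi.one_apply]
      refine ⟨i, ?_⟩
      have h1 := measureReal_cyl_pos (hx (i + 1))
      have h2 := measureReal_cyl_pos (hx' i)
      have h3 : Real.exp n * P.real (cyl (prefixWord x (i + 1))) ≤
          P.real (cyl (prefixWord (shift x) i)) := by
        rw [← Real.log_le_log_iff (by positivity) h2, Real.log_mul (by positivity) h1.ne',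
          Real.log_exp]
        unfold info at h
        linarith
      rw [← ENNReal.ofReal_toReal (measure_ne_top P (cyl (prefixWord x (i + 1)))),
        ← ENNReal.ofReal_toReal (measure_ne_top P (cyl (prefixWord (shift x) i))),
        ← ENNReal.ofReal_mul (Real.exp_pos _).le]
      exact ENNReal.ofReal_le_ofReal h3
    · exact zero_le
  have hbound : ∀ n : ℕ, P (E n) ≤ ENNReal.ofReal (Fintype.card A * Real.exp (-n)) := by
    intro n
    have h1 := mul_measure_exists_ratio_le (P := P) (ENNReal.ofReal (Real.exp n))
    calc P (E n) = ENNReal.ofReal (Real.exp (-n)) * (ENNReal.ofReal (Real.exp n) * P (E n)) := by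
          rw [← mul_assoc, ← ENNReal.ofReal_mul (Real.exp_pos _).le, ← Real.exp_add]
          simp
      _ ≤ ENNReal.ofReal (Real.exp (-n)) * Fintype.card A := by gcongr
      _ = _ := by
          rw [mul_comm, ENNReal.ofReal_mul (by positivity), ENNReal.ofReal_natCast]
  refine ne_top_of_le_ne_top ?_ (lintegral_mono_ae hle)
  rw [lintegral_tsum fun n => (measurable_one.indicator (hEm n)).aemeasurable]
  refine ne_top_of_le_ne_top ?_ (ENNReal.tsum_le_tsum (g := fun n : ℕ =>
    ENNReal.ofReal (Fintype.card A * Real.exp (-n))) fun n => ?_)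
  · exact (Real.summable_exp_neg_nat.mul_left _).tsum_ofReal_ne_top
  · rw [lintegral_indicator_one (hEm n)]
    exact hbound n

/-- The filtration of the σ-fields generated by the words `x_1^n`. -/
def prefixFiltration (A : Type*) [MeasurableSpace A] [MeasurableSingletonClass A] [Finite A] :
    Filtration ℕ (MeasurableSpace.pi : MeasurableSpace (ℕ → A)) where
  seq n := MeasurableSpace.comap (fun x : ℕ → A => prefixWord x n) ⊤
  mono' m n h := by
    rintro s ⟨t, -, rfl⟩
    refine ⟨List.take m ⁻¹' t, trivial, ?_⟩
    ext x
    simp [take_prefixWord x h]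
  le' n := by
    rintro s ⟨t, -, rfl⟩
    have := measurable_comp_prefixWord (fun u => u ∈ t) (A := A) n
    exact measurableSet_setOfPred.2 this

/-- The ratio is the conditional probability of a preceding letter a given the first n letters. The
martingale property is Σ_b P [aub] = P [au], and invariance bounds the ratio by 1. -/
theorem martingale_ratio (hP : MeasurePreserving shift P P) (a : A) :
    Martingale (fun n x => (P (cyl (a :: prefixWord x n)) / P (cyl (prefixWord x n))).toReal)
      (prefixFiltration A) P := by
  set q : List A → ℝ≥0∞ := fun u => P (cyl (a :: u)) / P (cyl u) with hq
  have hq1 : ∀ u, q u ≤ 1 := fun u =>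
    ENNReal.div_le_of_le_mul (by rw [one_mul]; exact measure_cyl_cons_le hP a u)
  have hqt : ∀ u, q u < ∞ := fun u => (hq1 u).trans_lt ENNReal.one_lt_top
  -- This also holds when P [u] = 0, since then P [au] = 0 by invariance.
  have hqm : ∀ u, q u * P (cyl u) = P (cyl (a :: u)) := fun u =>
    ENNReal.div_mul_cancel' (fun h => le_antisymm (h ▸ measure_cyl_cons_le hP a u) zero_le)
      fun h => absurd h (measure_ne_top _ _)
  have hqmeas : ∀ n, Measurable fun x : ℕ → A => q (prefixWord x n) :=
    measurable_comp_prefixWord q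
  refine martingale_of_setIntegral_eq_succ (fun n => ?_) (fun n => ?_) fun n s hs => ?_
  · refine Measurable.stronglyMeasurable ?_
    have h1 : Measurable[(prefixFiltration A) n, ⊤] fun x : ℕ → A => prefixWord x n :=
      comap_measurable _
    exact (@measurable_from_top (List A) ℝ _ fun u => (q u).toReal).comp h1
  · refine Integrable.of_bound (hqmeas n).ennreal_toReal.aestronglyMeasurable 1
      (ae_of_all _ fun x => ?_)
    rw [Real.norm_of_nonneg ENNReal.toReal_nonneg]
    exact ENNReal.toReal_le_of_le_ofReal zero_le_one (by simpa using hq1 _)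
  · obtain ⟨t, -, rfl⟩ := hs
    have hsm : MeasurableSet ((fun x : ℕ → A => prefixWord x n) ⁻¹' t) :=
      (prefixFiltration A).le n _ ⟨t, trivial, rfl⟩
    classical
    rw [integral_toReal (hqmeas n).aemeasurable (ae_of_all _ fun x => hqt _),
      integral_toReal (hqmeas (n + 1)).aemeasurable (ae_of_all _ fun x => hqt _),
      ← lintegral_indicator hsm, ← lintegral_indicator hsm]
    congr 1
    have h1 : ∀ x : ℕ → A, ((fun x : ℕ → A => prefixWord x n) ⁻¹' t).indicator
        (fun x => q (prefixWord x n)) x = (fun u => t.indicator 1 u * q u) (prefixWord x n) := by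
      intro x
      by_cases hx : prefixWord x n ∈ t <;> simp [hx, Set.indicator]
    have h2 : ∀ x : ℕ → A, ((fun x : ℕ → A => prefixWord x n) ⁻¹' t).indicator
        (fun x => q (prefixWord x (n + 1))) x =
          (fun u => t.indicator 1 u.dropLast * q u) (prefixWord x (n + 1)) := by
      intro x
      by_cases hx : prefixWord x n ∈ t <;> simp [hx, Set.indicator, prefixWord_succ]
    simp only [h1, h2]
    rw [lintegral_prefixWord P (fun u => t.indicator 1 u * q u),
      lintegral_prefixWord P (fun u => t.indicator 1 u.dropLast * q u), wordSum_succ_concat]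
    congr 1
    ext u
    simp only [List.dropLast_concat, mul_assoc, hqm]
    rw [← Finset.mul_sum]
    simp only [← List.cons_append]
    rw [sum_measure_cyl_concat]

theorem ae_tendsto_info (hP : MeasurePreserving shift P P) :
    ∀ᵐ x ∂P, ∃ c, Tendsto (fun i => info P i x) atTop (𝓝 c) := by
  have hconv : ∀ᵐ x ∂P, ∀ a : A, ∃ c, Tendsto (fun n =>
      (P (cyl (a :: prefixWord x n)) / P (cyl (prefixWord x n))).toReal) atTop (𝓝 c) := by
    refine ae_all_iff.2 fun a => ?_
    refine (martingale_ratio hP a).submartingale.exists_ae_tendsto_of_bdd (R := 1) fun n => ?_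
    refine (eLpNorm_le_of_ae_bound (C := 1) (ae_of_all _ fun x => ?_)).trans ?_
    · rw [Real.norm_of_nonneg ENNReal.toReal_nonneg]
      refine ENNReal.toReal_le_of_le_ofReal zero_le_one ?_
      simpa using ENNReal.div_le_of_le_mul
        (by rw [one_mul]; exact measure_cyl_cons_le hP a (prefixWord x n))
    · simp
  have hfin : ∀ᵐ x ∂P, ⨆ i, ENNReal.ofReal (info P i x) < ∞ :=
    ae_lt_top (.iSup fun i => (measurable_info P i).ennreal_ofReal)
      (lintegral_iSup_info_ne_top hP)
  -- The martingales are evaluated at the shifted point, with a the letter x 0 that was shifted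
  -- away.
  filter_upwards [hP.quasiMeasurePreserving.ae hconv, hfin, ae_measure_cyl_prefixWord_ne_zero P,
    hP.quasiMeasurePreserving.ae (ae_measure_cyl_prefixWord_ne_zero P)] with x hx hS h0 h0'
  obtain ⟨c, hc⟩ := hx (x 0)
  simp only [← prefixWord_succ_cons] at hc
  have hinfo : ∀ i, info P i x = -Real.log
      ((P (cyl (prefixWord x (i + 1))) / P (cyl (prefixWord (shift x) i))).toReal) := by
    intro i
    rw [ENNReal.toReal_div]
    change info P i x = -Real.log (P.real _ / P.real _)
    rw [Real.log_div (measureReal_cyl_pos (h0 _)).ne'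
      (measureReal_cyl_pos (h0' _)).ne', neg_sub]
    rfl
  have hle : ∀ i, info P i x ≤ (⨆ i, ENNReal.ofReal (info P i x)).toReal := fun i =>
    (ENNReal.ofReal_le_iff_le_toReal hS.ne).1 (le_iSup (fun i => ENNReal.ofReal (info P i x)) i)
  -- A zero limit would make the informations unbounded, so their finite supremum keeps c positive
  -- and the logarithm continuous there.
  have hc0 : 0 < c := by
    refine (Real.exp_pos (-(⨆ i, ENNReal.ofReal (info P i x)).toReal)).trans_le
      (ge_of_tendsto' hc fun i => ?_)
    have hpos : 0 < (P (cyl (prefixWord x (i + 1))) /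
        P (cyl (prefixWord (shift x) i))).toReal := by
      rw [ENNReal.toReal_div]
      exact div_pos (measureReal_cyl_pos (h0 _)) (measureReal_cyl_pos (h0' _))
    rw [← Real.le_log_iff_exp_le hpos]
    have := hle i
    rw [hinfo] at this
    linarith
  refine ⟨-Real.log c, ?_⟩
  simp only [hinfo]
  exact (hc.log hc0.ne').neg

theorem tendsto_lintegral_infoGap (hP : MeasurePreserving shift P P) :
    Tendsto (fun k => ∫⁻ x, infoGap P k x ∂P) atTop (𝓝 0) := by
  rw [← lintegral_zero (μ := P)]
  -- The supremum of the informations dominates because informations are nonnegative; pointwise, the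
  -- gap tends to 0 because a convergent sequence is Cauchy.
  refine tendsto_lintegral_of_dominated_convergence
    (fun x => ⨆ i, ENNReal.ofReal (info P i x)) (measurable_infoGap P) (fun k => ?_)
    (lintegral_iSup_info_ne_top hP) ?_
  · filter_upwards [ae_measure_cyl_prefixWord_ne_zero P] with x hx
    refine iSup_le fun i => le_trans (ENNReal.ofReal_le_ofReal ?_)
      (le_iSup (fun i => ENNReal.ofReal (info P i x)) k)
    linarith [info_nonneg hP hx (k + i)]
  · filter_upwards [ae_tendsto_info hP] with x ⟨c, hc⟩
    rw [ENNReal.tendsto_atTop_zero]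
    intro ε hε
    rcases eq_or_ne ε ∞ with rfl | hεt
    · exact ⟨0, fun _ _ => le_top⟩
    obtain ⟨N, hN⟩ := Metric.cauchySeq_iff.1 hc.cauchySeq ε.toReal (ENNReal.toReal_pos hε.ne' hεt)
    refine ⟨N, fun n hn => iSup_le fun i => ?_⟩
    rw [ENNReal.ofReal_le_iff_le_toReal hεt]
    have := hN n hn (n + i) (by omega)
    rw [Real.dist_eq] at this
    exact (le_abs_self _).trans this.le

end Information

/-! ### Two-sided comparison of a word with its parsings -/

section Bounds

variable {A : Type*} [MeasurableSpace A] [MeasurableSingletonClass A] [Fintype A]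
  {P : Measure (ℕ → A)} [IsProbabilityMeasure P]

theorem ae_measure_cyl_iterate_ne_zero (hP : MeasurePreserving shift P P) :
    ∀ᵐ x ∂P, ∀ j n, P (cyl (prefixWord (shift^[j] x) n)) ≠ 0 :=
  ae_all_iff.2 fun j =>
    (hP.iterate j).quasiMeasurePreserving.ae (ae_measure_cyl_prefixWord_ne_zero P)

theorem le_toReal_tsum {f : ℕ → ℝ≥0∞} (h : ∑' n, f n ≠ ∞) (n : ℕ) :
    (f n).toReal ≤ (∑' n, f n).toReal :=
  ENNReal.toReal_mono h (ENNReal.le_tsum n)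

/-- Chain rule: letter j is conditioned on the N - 1 - j letters that follow it in the word. -/
theorem log_measureReal_cyl_prefixWord {x : ℕ → A} (N : ℕ) :
    -Real.log (P.real (cyl (prefixWord x N))) =
      ∑ j ∈ Finset.range N, info P (N - 1 - j) (shift^[j] x) := by
  induction N generalizing x with
  | zero => simp
  | succ N ih =>
    rw [Finset.sum_range_succ', add_tsub_cancel_right]
    have : ∀ j ∈ Finset.range N, info P (N - (j + 1)) (shift^[j + 1] x) =
        info P (N - 1 - j) (shift^[j] (shift x)) := fun j _ => by
      rw [Nat.sub_sub, add_comm 1 j, Function.iterate_succ_apply]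
    rw [Finset.sum_congr rfl this, ← ih]
    simp only [Function.iterate_zero, id, info, tsub_zero]
    ring

/-- For j < N - k at least k letters follow, so replacing the chain-rule term by `info P k` costs at
most `infoGap`. The remaining chain-rule terms are nonnegative and can be dropped. -/
theorem sum_info_le_log_measureReal (hP : MeasurePreserving shift P P) {x : ℕ → A}
    (hx : ∀ j n, P (cyl (prefixWord (shift^[j] x) n)) ≠ 0) (k : ℕ)
    (hD : ∀ j, infoGap P k (shift^[j] x) ≠ ∞) (N : ℕ) :
    ∑ j ∈ Finset.range (N - k), info P k (shift^[j] x) ≤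
      -Real.log (P.real (cyl (prefixWord x N))) +
        ∑ j ∈ Finset.range N, (infoGap P k (shift^[j] x)).toReal := by
  rw [log_measureReal_cyl_prefixWord, ← Finset.sum_add_distrib]
  refine le_trans (Finset.sum_le_sum fun j hj => ?_) (Finset.sum_le_sum_of_subset_of_nonneg
    (Finset.range_mono (Nat.sub_le N k)) fun j _ _ =>
      add_nonneg (info_nonneg hP (hx j) _) ENNReal.toReal_nonneg)
  rw [Finset.mem_range] at hj
  have h1 : ENNReal.ofReal (info P k (shift^[j] x) - info P (k + (N - 1 - j - k)) (shift^[j] x)) ≤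
      infoGap P k (shift^[j] x) :=
    le_iSup (fun i => ENNReal.ofReal (info P k (shift^[j] x) - info P (k + i) (shift^[j] x))) _
  rw [ENNReal.ofReal_le_iff_le_toReal (hD j),
    show k + (N - 1 - j - k) = N - 1 - j by omega] at h1
  linarith

theorem toReal_revMarkov [Nonempty A] {x : ℕ → A}
    (hx : ∀ j n, P (cyl (prefixWord (shift^[j] x) n)) ≠ 0) (k n : ℕ) :
    (revMarkov P k (prefixWord x n)).toReal =
      Real.exp (-((min n k : ℕ) * Real.log (Fintype.card A) +
        ∑ j ∈ Finset.range (n - k), info P k (shift^[j] x))) := by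
  induction n generalizing x with
  | zero => simp [revMarkov]
  | succ n ih =>
    have hx1 : ∀ j n, P (cyl (prefixWord (shift^[j] (shift x)) n)) ≠ 0 := fun j => hx (j + 1)
    rw [prefixWord_succ_cons, revMarkov, ENNReal.toReal_mul, ih hx1, length_prefixWord]
    split_ifs with h
    · rw [min_eq_left h.le, min_eq_left (Nat.succ_le_of_lt h), Nat.sub_eq_zero_of_le h.le,
        Nat.sub_eq_zero_of_le (Nat.succ_le_of_lt h)]
      have hc : (0 : ℝ) < Fintype.card A := by exact_mod_cast Fintype.card_pos
      push_cast
      rw [show -(((n : ℝ) + 1) * Real.log (Fintype.card A) + ∑ j ∈ Finset.range 0,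
        info P k (shift^[j] x)) = -Real.log (Fintype.card A) + -(n * Real.log (Fintype.card A) +
          ∑ j ∈ Finset.range 0, info P k (shift^[j] (shift x))) by simp; ring, Real.exp_add,
        Real.exp_neg (Real.log _), Real.exp_log hc]
      simp
    · rw [not_lt] at h
      rw [min_eq_right h, min_eq_right (by omega), Nat.succ_sub h, Finset.sum_range_succ',
        take_prefixWord _ h, ← prefixWord_succ_cons, ENNReal.toReal_div]
      have h1 : 0 < P.real (cyl (prefixWord x (k + 1))) := measureReal_cyl_pos (hx 0 (k + 1))
      have h2 : 0 < P.real (cyl (prefixWord (shift x) k)) := measureReal_cyl_pos (hx 1 k)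
      have h3 : P.real (cyl (prefixWord x (k + 1))) / P.real (cyl (prefixWord (shift x) k)) =
          Real.exp (-info P k x) := by
        rw [info, neg_sub, Real.exp_sub, Real.exp_log h1, Real.exp_log h2]
      change P.real _ / P.real _ * _ = _
      rw [h3, ← Real.exp_add]
      congr 1
      simp only [Function.iterate_succ_apply, Function.iterate_zero, id]
      ring

theorem log_le_add_exp_mul {y : ℝ} (hy : 0 < y) (t : ℝ) :
    Real.log y ≤ t + Real.exp (-t) * y := by
  have h := Real.log_le_sub_one_of_pos (mul_pos (Real.exp_pos (-t)) hy)
  rw [Real.log_mul (Real.exp_pos _).ne' hy.ne', Real.log_exp] at h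
  linarith

/-- A discounted sum of the likelihood ratios between the Markov approximation and `P`. -/
noncomputable def ratioSum (P : Measure (ℕ → A)) (k : ℕ) (s b : ℝ) (x : ℕ → A) : ℝ≥0∞ :=
  ∑' n : ℕ, ENNReal.ofReal (Real.exp (-(s * n + b))) *
    (revMarkov P k (prefixWord x n) / P (cyl (prefixWord x n)))

theorem measurable_ratioSum (k : ℕ) (s b : ℝ) : Measurable (ratioSum P k s b) :=
  Measurable.tsum fun n =>
    (measurable_comp_prefixWord (fun u => revMarkov P k u / P (cyl u)) n).const_mul _

theorem lintegral_ratioSum_le (hP : MeasurePreserving shift P P) (k : ℕ) {s : ℝ} (hs : 0 < s)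
    (b : ℝ) :
    ∫⁻ x, ratioSum P k s b x ∂P ≤ ENNReal.ofReal (Real.exp (-b) * (1 - Real.exp (-s))⁻¹) := by
  unfold ratioSum
  have hm := fun n => measurable_comp_prefixWord (A := A) (fun u => revMarkov P k u / P (cyl u)) n
  rw [lintegral_tsum fun n => ((hm n).const_mul _).aemeasurable]
  have hle : ∀ n : ℕ, ∫⁻ x, ENNReal.ofReal (Real.exp (-(s * n + b))) *
      (revMarkov P k (prefixWord x n) / P (cyl (prefixWord x n))) ∂P ≤
        ENNReal.ofReal (Real.exp (-b) * Real.exp (-s) ^ n) := by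
    intro n
    rw [lintegral_const_mul _ (hm n), ← Real.exp_nat_mul, ← Real.exp_add,
      show -b + n * -s = -(s * n + b) by ring]
    exact mul_le_of_le_one_right zero_le
      ((lintegral_ratio_le P (revMarkov P k) n).trans (wordSum_revMarkov_le hP k n))
  refine (ENNReal.tsum_le_tsum hle).trans ?_
  have h1 : Real.exp (-s) < 1 := Real.exp_lt_one_iff.2 (by linarith)
  rw [← ENNReal.ofReal_tsum_of_nonneg (fun n => by positivity)
    ((summable_geometric_of_lt_one (Real.exp_pos _).le h1).mul_left _), tsum_mul_left,
    tsum_geometric_of_lt_one (Real.exp_pos _).le h1]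

/-- Apply log y ≤ t + e^{-t} y to y = M/P with t = sn + b; the last term is then one summand of
`ratioSum`. The final min(n, k) letters, which the chain draws uniformly, cost at most k log |A|. -/
theorem neg_log_measureReal_le [Nonempty A] {x : ℕ → A}
    (hx : ∀ j n, P (cyl (prefixWord (shift^[j] x) n)) ≠ 0) (k : ℕ) {s b : ℝ}
    (hF : ratioSum P k s b x ≠ ∞) (n : ℕ) :
    -Real.log (P.real (cyl (prefixWord x n))) ≤ s * n + (b + k * Real.log (Fintype.card A)) +
      ∑ j ∈ Finset.range (n - k), info P k (shift^[j] x) + (ratioSum P k s b x).toReal := by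
  have hM := toReal_revMarkov hx k n
  have hp := measureReal_cyl_pos (hx 0 n)
  rw [Function.iterate_zero, id] at hp
  have hMpos : 0 < (revMarkov P k (prefixWord x n)).toReal := hM ▸ Real.exp_pos _
  have h1 := log_le_add_exp_mul (div_pos hMpos hp) (s * n + b)
  have h2 := le_toReal_tsum hF n
  rw [ENNReal.toReal_mul, ENNReal.toReal_ofReal (Real.exp_pos _).le, ENNReal.toReal_div] at h2
  change _ * (_ / P.real _) ≤ (ratioSum P k s b x).toReal at h2
  rw [Real.log_div hMpos.ne' hp.ne', hM, Real.log_exp, ← hM] at h1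
  have h3 : ((min n k : ℕ) : ℝ) * Real.log (Fintype.card A) ≤ k * Real.log (Fintype.card A) := by
    gcongr
    exact min_le_right _ _
  linarith

theorem neg_sum_log_le [Nonempty A] (hP : MeasurePreserving shift P P) (k : ℕ) {s b : ℝ}
    (ws : List (List A)) (hws : ∀ w ∈ ws, w ≠ []) {x : ℕ → A}
    (hx : ∀ j n, P (cyl (prefixWord (shift^[j] x) n)) ≠ 0)
    (hF : ∀ j, ratioSum P k s b (shift^[j] x) ≠ ∞) {N : ℕ} (h : ws.flatten = prefixWord x N) :
    -(ws.map fun w => Real.log (P.real (cyl w))).sum ≤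
      s * N + (b + k * Real.log (Fintype.card A)) * ws.length +
        ∑ j ∈ Finset.range (N - k), info P k (shift^[j] x) +
        ∑ j ∈ Finset.range N, (ratioSum P k s b (shift^[j] x)).toReal := by
  induction ws generalizing x N with
  | nil =>
    obtain rfl : N = 0 := by simpa using congrArg List.length h.symm
    simp
  | cons w ws ih =>
    have hlen := congrArg List.length h
    rw [List.flatten_cons, List.length_append, length_prefixWord] at hlen
    obtain ⟨n, hn⟩ : ∃ n, w.length = n := ⟨_, rfl⟩
    have hn0 : 0 < n := hn ▸ List.length_pos_of_ne_nil (hws w (by simp))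
    obtain ⟨d, rfl⟩ : ∃ d, N = n + d := ⟨ws.flatten.length, by omega⟩
    rw [List.flatten_cons, prefixWord_add] at h
    obtain ⟨rfl, h2⟩ := List.append_inj h (by simp [hn])
    have h3 := ih (fun w hw => hws w (by simp [hw])) (x := shift^[n] x)
      (fun j => by simpa only [← Function.iterate_add_apply] using hx (j + n))
      (fun j => by simpa only [← Function.iterate_add_apply] using hF (j + n)) h2
    have h4 := neg_log_measureReal_le hx k (hF 0) n
    -- Each block omits its own last k positions, so the blocks use disjoint positions, all before
    -- the last k of the whole word; `info` is nonnegative elsewhere.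
    have h5 : ∑ j ∈ Finset.range (n - k), info P k (shift^[j] x) +
        ∑ j ∈ Finset.range (d - k), info P k (shift^[j] (shift^[n] x)) ≤
          ∑ j ∈ Finset.range (n + d - k), info P k (shift^[j] x) := by
      simp only [← Function.iterate_add_apply]
      have hnn : ∀ j, 0 ≤ info P k (shift^[j] x) := fun j => info_nonneg hP (hx j) k
      rcases le_total k d with hkd | hkd
      · rw [Nat.add_sub_assoc hkd, Finset.sum_range_add]
        simp only [add_comm _ n]
        exact add_le_add (Finset.sum_le_sum_of_subset_of_nonneg (Finset.range_mono
          (Nat.sub_le n k)) fun j _ _ => hnn j) le_rfl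
      · rw [Nat.sub_eq_zero_of_le hkd, Finset.sum_range_zero, add_zero]
        exact Finset.sum_le_sum_of_subset_of_nonneg (Finset.range_mono (by omega))
          fun j _ _ => hnn j
    -- `ratioSum` is needed only at the starting points of blocks. Blocks being nonempty, these are
    -- distinct, and summing over all positions removes the dependence on the parsing.
    have h6 : (ratioSum P k s b x).toReal +
        ∑ j ∈ Finset.range d, (ratioSum P k s b (shift^[j] (shift^[n] x))).toReal ≤
          ∑ j ∈ Finset.range (n + d), (ratioSum P k s b (shift^[j] x)).toReal := by
      rw [Finset.sum_range_add]
      simp only [← Function.iterate_add_apply, add_comm _ n]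
      gcongr
      exact Finset.single_le_sum (f := fun j => (ratioSum P k s b (shift^[j] x)).toReal)
        (fun j _ => ENNReal.toReal_nonneg) (Finset.mem_range.2 hn0)
    rw [List.map_cons, List.sum_cons, List.length_cons]
    push_cast
    linarith

theorem lintegral_comp_iterate_ne_top (hP : MeasurePreserving shift P P) {H : (ℕ → A) → ℝ≥0∞}
    (hH : Measurable H) (hI : ∫⁻ x, H x ∂P ≠ ∞) : ∀ᵐ x ∂P, ∀ j, H (shift^[j] x) ≠ ∞ := by
  have h : ∀ᵐ x ∂P, H x ≠ ∞ := (ae_lt_top hH hI).mono fun x hx => hx.ne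
  exact ae_all_iff.2 fun j => (hP.iterate j).quasiMeasurePreserving.ae h

/-- Parsings into few blocks do not have much smaller probability than the whole word. -/
theorem exists_log_sub_sum_log_le (hP : MeasurePreserving shift P P) {ε : ℝ} (hε : 0 < ε) :
    ∃ B : ℝ, 0 ≤ B ∧ ∃ H : (ℕ → A) → ℝ≥0∞, Measurable H ∧ ∫⁻ x, H x ∂P ≤ ENNReal.ofReal ε ∧
      ∀ᵐ x ∂P, (∀ j, H (shift^[j] x) ≠ ∞) ∧ ∀ N (ws : List (List A)), (∀ w ∈ ws, w ≠ []) →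
        ws.flatten = prefixWord x N →
        Real.log (P.real (cyl (prefixWord x N))) -
          (ws.map fun w => Real.log (P.real (cyl w))).sum ≤
            ε * N + B * ws.length + ∑ j ∈ Finset.range N, (H (shift^[j] x)).toReal := by
  have : Nonempty A := by
    obtain ⟨x⟩ := nonempty_of_isProbabilityMeasure P
    exact ⟨x 0⟩
  have hε2 : (0 : ℝ≥0∞) < ENNReal.ofReal (ε / 2) := ENNReal.ofReal_pos.2 (half_pos hε)
  -- First k is chosen to make the gap small in mean, then b to do the same for the ratio sum; both
  -- choices are paid once per block, in B.
  obtain ⟨k, hk⟩ := ((tendsto_lintegral_infoGap hP).eventually_le_const hε2).exists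
  have hb : Tendsto (fun b : ℝ => Real.exp (-b) * (1 - Real.exp (-ε))⁻¹) atTop (𝓝 0) := by
    simpa using Real.tendsto_exp_neg_atTop_nhds_zero.mul_const (1 - Real.exp (-ε))⁻¹
  obtain ⟨b, hb, hb0⟩ :=
    ((hb.eventually_le_const (half_pos hε)).and (eventually_ge_atTop (0 : ℝ))).exists
  have hF : ∫⁻ x, ratioSum P k ε b x ∂P ≤ ENNReal.ofReal (ε / 2) :=
    (lintegral_ratioSum_le hP k hε b).trans (ENNReal.ofReal_le_ofReal hb)
  refine ⟨b + k * Real.log (Fintype.card A), ?_, fun x => infoGap P k x + ratioSum P k ε b x,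
    (measurable_infoGap P k).add (measurable_ratioSum k ε b), ?_, ?_⟩
  · have := Real.log_natCast_nonneg (Fintype.card A)
    positivity
  · rw [lintegral_add_left (measurable_infoGap P k), ← add_halves ε,
      ENNReal.ofReal_add (half_pos hε).le (half_pos hε).le, add_halves ε]
    exact add_le_add hk hF
  · filter_upwards [ae_measure_cyl_iterate_ne_zero hP,
      lintegral_comp_iterate_ne_top hP (measurable_infoGap P k)
        (ne_top_of_le_ne_top ENNReal.ofReal_ne_top hk),
      lintegral_comp_iterate_ne_top hP (measurable_ratioSum k ε b)
        (ne_top_of_le_ne_top ENNReal.ofReal_ne_top hF)] with x hx hD hR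
    refine ⟨fun j => ENNReal.add_ne_top.2 ⟨hD j, hR j⟩, fun N ws hws h => ?_⟩
    have h1 := neg_sum_log_le hP k ws hws hx hR h
    have h2 := sum_info_le_log_measureReal hP hx k hD N
    simp only [ENNReal.toReal_add (hD _) (hR _), Finset.sum_add_distrib]
    linarith

theorem log_prod_map {α : Type*} (f : α → ℝ) (l : List α) (h : ∀ a ∈ l, f a ≠ 0) :
    Real.log (l.map f).prod = (l.map fun a => Real.log (f a)).sum := by
  induction l with
  | nil => simp
  | cons a l ih =>
    have h1 : (l.map f).prod ≠ 0 := List.prod_ne_zero fun h0 => by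
      obtain ⟨b, hb, hb0⟩ := List.mem_map.1 h0
      exact h b (by simp [hb]) hb0
    simp only [List.map_cons, List.prod_cons, List.sum_cons]
    rw [Real.log_mul (h a (by simp)) h1, ih fun b hb => h b (by simp [hb])]

theorem measure_cyl_ne_zero_of_mem (hP : MeasurePreserving shift P P) {ws : List (List A)}
    (h : P (cyl ws.flatten) ≠ 0) {w : List A} (hw : w ∈ ws) : P (cyl w) ≠ 0 := by
  obtain ⟨l, r, rfl⟩ := List.append_of_mem hw
  rw [List.flatten_append, List.flatten_cons] at h
  intro h0
  refine h (le_antisymm ?_ zero_le)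
  rw [← h0]
  exact (measure_cyl_append_le_right hP _ _).trans (measure_cyl_append_le P _ _)

/-- Parsings into few blocks do not have much larger probability than the whole word. -/
theorem exists_sum_log_sub_log_le (hP : MeasurePreserving shift P P) {ε : ℝ} (hε : 0 < ε) :
    ∃ B : ℝ, 0 ≤ B ∧ ∃ E : ℕ → (ℕ → A) → ℝ≥0∞, (∀ N, Measurable (E N)) ∧
      ∑' N, ∫⁻ x, E N x ∂P ≠ ∞ ∧
      ∀ᵐ x ∂P, (∀ N, E N x ≠ ∞) ∧ ∀ N (ws : List (List A)), (∀ w ∈ ws, w ≠ []) →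
        ws.flatten = prefixWord x N →
        (ws.map fun w => Real.log (P.real (cyl w))).sum -
          Real.log (P.real (cyl (prefixWord x N))) ≤
            ε * N + B * ws.length + (E N x).toReal := by
  have hs : Real.exp (-(ε / 2)) < 1 := Real.exp_lt_one_iff.2 (by linarith)
  -- γ^N is paid twice, for the positions without cuts and for summability over N, hence the half of
  -- ε. Each block costs -log (1 - γ).
  set γ : ℝ := Real.exp (-(ε / 2)) with hγ
  have hγ0 : 0 < γ := Real.exp_pos _
  set Q : List A → ℝ≥0∞ := mixture P (ENNReal.ofReal (1 - γ)) (ENNReal.ofReal γ) [] with hQ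
  have hm := fun n => measurable_comp_prefixWord (A := A) (fun u => Q u / P (cyl u)) n
  have hQsum : ∀ n, wordSum n Q ≤ 1 := fun n => by
    refine (wordSum_mixture_le P ?_ n []).trans prob_le_one
    rw [← ENNReal.ofReal_add hγ0.le (by linarith)]
    simp
  have hint : ∑' N : ℕ, ∫⁻ x, ENNReal.ofReal (γ ^ N) *
      (Q (prefixWord x N) / P (cyl (prefixWord x N))) ∂P ≠ ∞ := by
    refine ne_top_of_le_ne_top (summable_geometric_of_lt_one hγ0.le hs).tsum_ofReal_ne_top
      (ENNReal.tsum_le_tsum fun N => ?_)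
    rw [lintegral_const_mul _ (hm N)]
    exact mul_le_of_le_one_right zero_le ((lintegral_ratio_le P Q N).trans (hQsum N))
  refine ⟨-Real.log (1 - γ), ?_, fun N x => ENNReal.ofReal (γ ^ N) *
    (Q (prefixWord x N) / P (cyl (prefixWord x N))), fun N => (hm N).const_mul _, hint, ?_⟩
  · have := Real.log_nonpos (x := 1 - γ) (by linarith) (by linarith)
    linarith
  have hfin : ∀ᵐ x ∂P, ∀ N : ℕ, ENNReal.ofReal (γ ^ N) *
      (Q (prefixWord x N) / P (cyl (prefixWord x N))) ≠ ∞ := by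
    refine ae_all_iff.2 fun N => ?_
    exact (ae_lt_top ((hm N).const_mul _) (ENNReal.ne_top_of_tsum_ne_top hint N)).mono
      fun x hx => hx.ne
  filter_upwards [ae_measure_cyl_prefixWord_ne_zero P, hfin] with x hx hE
  refine ⟨hE, fun N ws hws h => ?_⟩
  have h1 := le_mixture_flatten P (β := ENNReal.ofReal (1 - γ)) (γ := ENNReal.ofReal γ)
    (ENNReal.ofReal_le_one.2 hs.le) ws hws []
  rw [h, length_prefixWord, cyl_nil, measure_univ, one_mul, ← hQ] at h1
  have hpos : ∀ w ∈ ws, 0 < P.real (cyl w) := fun w hw =>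
    measureReal_cyl_pos (measure_cyl_ne_zero_of_mem hP (h ▸ hx N) hw)
  have hp := measureReal_cyl_pos (hx N)
  have hprod : 0 < (ws.map fun w => P.real (cyl w)).prod :=
    List.prod_pos fun a ha => by
      obtain ⟨w, hw, rfl⟩ := List.mem_map.1 ha
      exact hpos w hw
  have hprod' : (ws.map fun w => P (cyl w)).prod.toReal = (ws.map fun w => P.real (cyl w)).prod := by
    have := map_list_prod ENNReal.toRealHom (ws.map fun w => P (cyl w))
    rw [List.map_map] at this
    exact this
  have h2 : γ ^ N * ((1 - γ) ^ ws.length * γ ^ N * (ws.map fun w => P.real (cyl w)).prod /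
      P.real (cyl (prefixWord x N))) ≤ (ENNReal.ofReal (γ ^ N) *
      (Q (prefixWord x N) / P (cyl (prefixWord x N)))).toReal := by
    have h3 : ENNReal.ofReal (γ ^ N) * (ENNReal.ofReal (1 - γ) ^ ws.length *
        ENNReal.ofReal γ ^ N * (ws.map fun w => P (cyl w)).prod / P (cyl (prefixWord x N))) ≤
        ENNReal.ofReal (γ ^ N) * (Q (prefixWord x N) / P (cyl (prefixWord x N))) := by
      gcongr
    have h4 := ENNReal.toReal_mono (hE N) h3
    simpa only [Measure.real, ENNReal.toReal_mul, ENNReal.toReal_div, ENNReal.toReal_pow,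
      ENNReal.toReal_ofReal hγ0.le, ENNReal.toReal_ofReal (sub_pos.2 hs).le,
      ENNReal.toReal_ofReal (pow_pos hγ0 N).le, hprod'] using h4
  have hβ0 : 0 < 1 - γ := sub_pos.2 hs
  have h5 := (Real.log_le_sub_one_of_pos (mul_pos (pow_pos hγ0 N) (div_pos (mul_pos (mul_pos
    (pow_pos hβ0 ws.length) (pow_pos hγ0 N)) hprod) hp))).trans (sub_le_self _ zero_le_one)
  have h6 := h5.trans h2
  rw [Real.log_mul (by positivity) (by positivity), Real.log_div (by positivity) (by positivity),
    Real.log_mul (by positivity) (by positivity), Real.log_mul (by positivity) (by positivity),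
    Real.log_pow, Real.log_pow, log_prod_map _ _ fun w hw => (hpos w hw).ne', hγ, Real.log_exp,
    ← hγ] at h6
  linarith

end Bounds

/-! ### Almost sure and L¹ convergence of the normalized log-ratio -/

section Parsings

variable {A : Type*} [MeasurableSpace A] [MeasurableSingletonClass A]

/-- The logarithm of `P [x_1^N] / ∏ P [w_i]`. -/
noncomputable def Parsing.logRatio (W : Parsing A) (P : Measure (ℕ → A)) (N : ℕ) (x : ℕ → A) : ℝ :=
  if N = 0 then 0 else Real.log (P.real (cyl (prefixWord x N))) -
    ∑ i ∈ Finset.range (W.c N x), Real.log (P.real (cyl (W.block N i x)))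

/-- The list of the blocks of a parsing. -/
def Parsing.blocks (W : Parsing A) (N : ℕ) (x : ℕ → A) : List (List A) :=
  (List.range (W.c N x)).map fun i => W.block N i x

theorem Parsing.length_blocks (W : Parsing A) (N : ℕ) (x : ℕ → A) :
    (W.blocks N x).length = W.c N x := by
  simp [Parsing.blocks]

theorem Parsing.ne_nil_of_mem_blocks (W : Parsing A) {N : ℕ} (hN : 1 ≤ N) {x : ℕ → A} :
    ∀ w ∈ W.blocks N x, w ≠ [] := by
  intro w hw
  obtain ⟨i, hi, rfl⟩ := List.mem_map.1 hw
  exact List.ne_nil_of_length_pos (W.one_le_length N hN x i (List.mem_range.1 hi))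

theorem Parsing.sum_map_blocks (W : Parsing A) (f : List A → ℝ) (N : ℕ) (x : ℕ → A) :
    ((W.blocks N x).map f).sum = ∑ i ∈ Finset.range (W.c N x), f (W.block N i x) := by
  rw [Parsing.blocks, List.map_map]
  rfl

theorem Parsing.measurable_block [Finite A] (W : Parsing A) {N : ℕ} (hN : 1 ≤ N)
    (f : List A → ℝ) (i : ℕ) :
    Measurable fun x => if i < W.c N x then f (W.block N i x) else 0 := by
  have : Countable A := Finite.to_countable
  -- Only on {i < c_N} is the block measurable; the value `none` stands for its absence and makes
  -- the map total with countable range.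
  let : MeasurableSpace (Option (List A)) := ⊤
  have h : Measurable fun x => if i < W.c N x then some (W.block N i x) else none := by
    refine measurable_to_countable' fun o => ?_
    rcases o with _ | u
    · have : (fun x => if i < W.c N x then some (W.block N i x) else none) ⁻¹' {none} =
          {x | i < W.c N x}ᶜ := by
        ext x
        by_cases h : i < W.c N x <;> simp [h]
      rw [this]
      exact (measurableSet_lt measurable_const (W.measurable_c N hN)).compl
    · have : (fun x => if i < W.c N x then some (W.block N i x) else none) ⁻¹' {some u} =
          {x | i < W.c N x ∧ W.block N i x = u} := by
        ext x
        by_cases h : i < W.c N x <;> simp [h]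
      rw [this]
      exact W.measurableSet_block N hN i u
  have h2 : (fun x => if i < W.c N x then f (W.block N i x) else 0) = (fun o : Option (List A) =>
      o.elim 0 f) ∘ fun x => if i < W.c N x then some (W.block N i x) else none := by
    ext x
    by_cases h : i < W.c N x <;> simp [h]
  rw [h2]
  exact measurable_from_top.comp h

theorem Parsing.measurable_logRatio [Finite A] (W : Parsing A) (P : Measure (ℕ → A)) (N : ℕ) :
    Measurable (W.logRatio P N) := by
  rcases Nat.eq_zero_or_pos N with rfl | hN
  · exact measurable_const
  have : W.logRatio P N = fun x => Real.log (P.real (cyl (prefixWord x N))) -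
      ∑ i ∈ Finset.range N,
        if i < W.c N x then Real.log (P.real (cyl (W.block N i x))) else 0 := by
    ext x
    rw [Parsing.logRatio, if_neg hN.ne', ← Finset.sum_filter]
    congr 1
    refine Finset.sum_congr ?_ fun _ _ => rfl
    ext i
    have := W.c_le N hN x
    simp only [Finset.mem_range, Finset.mem_filter]
    omega
  rw [this]
  refine (measurable_comp_prefixWord (fun u => Real.log (P.real (cyl u))) N).sub ?_
  exact Finset.measurable_sum _ fun i _ =>
    W.measurable_block hN (fun u => Real.log (P.real (cyl u))) i

variable [Fintype A] {P : Measure (ℕ → A)} [IsProbabilityMeasure P]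

theorem Parsing.measureReal_eq_prod_mul_exp (hP : MeasurePreserving shift P P) (W : Parsing A)
    {N : ℕ} (hN : 1 ≤ N) {x : ℕ → A} (hx : P (cyl (prefixWord x N)) ≠ 0) :
    P.real (cyl (prefixWord x N)) =
      (∏ i ∈ Finset.range (W.c N x), P.real (cyl (W.block N i x))) *
        Real.exp (W.logRatio P N x) := by
  have hpos : ∀ i ∈ Finset.range (W.c N x), 0 < P.real (cyl (W.block N i x)) := fun i hi => by
    refine measureReal_cyl_pos (measure_cyl_ne_zero_of_mem hP (ws := W.blocks N x) ?_
      (List.mem_map_of_mem (List.mem_range.2 (Finset.mem_range.1 hi))))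
    rwa [Parsing.blocks, W.flatten_eq N hN]
  rw [Parsing.logRatio, if_neg (by omega), ← Real.log_prod fun i hi => (hpos i hi).ne',
    Real.exp_sub, Real.exp_log (measureReal_cyl_pos hx), Real.exp_log (Finset.prod_pos hpos),
    mul_div_cancel₀ _ (Finset.prod_pos hpos).ne']

theorem Parsing.exists_logRatio_le (hP : MeasurePreserving shift P P) (W : Parsing A) {ε : ℝ}
    (hε : 0 < ε) :
    ∃ B : ℝ, 0 ≤ B ∧ ∃ H : (ℕ → A) → ℝ≥0∞, Measurable H ∧ ∫⁻ x, H x ∂P ≤ ENNReal.ofReal ε ∧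
      ∀ᵐ x ∂P, (∀ j, H (shift^[j] x) ≠ ∞) ∧ ∀ N : ℕ, 1 ≤ N → W.logRatio P N x ≤
        ε * N + B * W.c N x + ∑ j ∈ Finset.range N, (H (shift^[j] x)).toReal := by
  obtain ⟨B, hB, H, hH, hI, h⟩ := exists_log_sub_sum_log_le hP hε
  refine ⟨B, hB, H, hH, hI, h.mono fun x hx => ⟨hx.1, fun N hN => ?_⟩⟩
  have := hx.2 N (W.blocks N x) (W.ne_nil_of_mem_blocks hN) (W.flatten_eq N hN x)
  rw [W.sum_map_blocks (fun w => Real.log (P.real (cyl w))), W.length_blocks] at this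
  rwa [Parsing.logRatio, if_neg (by omega)]

theorem Parsing.exists_neg_logRatio_le (hP : MeasurePreserving shift P P) (W : Parsing A) {ε : ℝ}
    (hε : 0 < ε) :
    ∃ B : ℝ, 0 ≤ B ∧ ∃ E : ℕ → (ℕ → A) → ℝ≥0∞, (∀ N, Measurable (E N)) ∧
      ∑' N, ∫⁻ x, E N x ∂P ≠ ∞ ∧
      ∀ᵐ x ∂P, (∀ N, E N x ≠ ∞) ∧ ∀ N : ℕ, 1 ≤ N → -W.logRatio P N x ≤
        ε * N + B * W.c N x + (E N x).toReal := by
  obtain ⟨B, hB, E, hE, hI, h⟩ := exists_sum_log_sub_log_le hP hε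
  refine ⟨B, hB, E, hE, hI, h.mono fun x hx => ⟨hx.1, fun N hN => ?_⟩⟩
  have := hx.2 N (W.blocks N x) (W.ne_nil_of_mem_blocks hN) (W.flatten_eq N hN x)
  rw [W.sum_map_blocks (fun w => Real.log (P.real (cyl w))), W.length_blocks] at this
  rwa [Parsing.logRatio, if_neg (by omega), neg_sub]

theorem eventually_mul_le_mul {u : ℕ → ℝ} (hu : Tendsto (fun N => u N / (N : ℝ)) atTop (𝓝 0))
    (B : ℝ) {δ : ℝ} (hδ : 0 < δ) : ∀ᶠ N : ℕ in atTop, B * u N ≤ δ * N := by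
  have h := hu.const_mul B
  rw [mul_zero] at h
  filter_upwards [h.eventually_le_const hδ, eventually_gt_atTop 0] with N h1 h2
  have : (0 : ℝ) < N := by exact_mod_cast h2
  rw [← mul_div_assoc, div_le_iff₀ this] at h1
  exact h1

/-- The exceptional event does not depend on η, while the bound used does: with ∫ H ≤ (δ/4) min(1,
η), the maximal inequality at level δ/4 shows that the event has measure at most η. Off the maximal
event, the linear term, the block term and the ergodic sum are each at most δN/4 for large N. -/
theorem Parsing.ae_eventually_logRatio_le (hP : MeasurePreserving shift P P) (W : Parsing A)
    (hW : ∀ᵐ x ∂P, Tendsto (fun N : ℕ => (W.c N x : ℝ) / (N : ℝ)) atTop (𝓝 0)) {δ : ℝ}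
    (hδ : 0 < δ) : ∀ᵐ x ∂P, ∀ᶠ N : ℕ in atTop, W.logRatio P N x ≤ δ * N := by
  rw [ae_iff]
  refine le_antisymm (le_of_forall_gt fun η' hη' => ?_) zero_le
  obtain ⟨η, hη, hηle⟩ : ∃ η : ℝ, 0 < η ∧ ENNReal.ofReal η < η' := by
    obtain ⟨q, hq, hq'⟩ := ENNReal.lt_iff_exists_nnreal_btwn.1 hη'
    exact ⟨q, by exact_mod_cast hq, by simpa using hq'⟩
  refine lt_of_le_of_lt ?_ hηle
  have hm : 0 < min 1 η := lt_min one_pos hη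
  have hδ4 : 0 < δ / 4 := by linarith
  obtain ⟨B, hB, H, hH, hI, h⟩ := W.exists_logRatio_le hP (mul_pos hδ4 hm)
  have hl : ENNReal.ofReal (δ / 4) ≠ 0 := (ENNReal.ofReal_pos.2 hδ4).ne'
  have hmax := (maximal_ergodic_inequality hP hH (ENNReal.ofReal (δ / 4))).trans hI
  rw [ENNReal.ofReal_mul hδ4.le, ENNReal.mul_le_mul_iff_right hl ENNReal.ofReal_ne_top] at hmax
  refine le_trans (measure_mono_ae ?_)
    (hmax.trans (ENNReal.ofReal_le_ofReal (min_le_right 1 η)))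
  filter_upwards [h, hW] with x hx hWx hbad
  by_contra hno
  refine hbad ?_
  filter_upwards [eventually_mul_le_mul hWx B hδ4, eventually_ge_atTop 1] with N h1 h2
  have h3 := hx.2 N h2
  have h4 : ∑ j ∈ Finset.range N, H (shift^[j] x) ≤ ENNReal.ofReal (δ / 4) * N := by
    by_contra h5
    exact hno ⟨N, h2, (not_le.1 h5).le⟩
  rw [← ENNReal.ofReal_natCast, ← ENNReal.ofReal_mul hδ4.le] at h4
  have h5 := ENNReal.toReal_le_of_le_ofReal (by positivity) h4
  rw [ENNReal.toReal_sum fun j _ => hx.1 j] at h5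
  have h6 : δ / 4 * min 1 η * N ≤ δ / 4 * N := by
    gcongr
    exact mul_le_of_le_one_right hδ4.le (min_le_left 1 η)
  have h7 : 0 ≤ δ * N := by positivity
  linarith

/-- Here the errors E_N have summable means, so they tend to 0 almost surely and no ergodic argument
is needed. -/
theorem Parsing.ae_eventually_neg_logRatio_le (hP : MeasurePreserving shift P P) (W : Parsing A)
    (hW : ∀ᵐ x ∂P, Tendsto (fun N : ℕ => (W.c N x : ℝ) / (N : ℝ)) atTop (𝓝 0)) {δ : ℝ}
    (hδ : 0 < δ) : ∀ᵐ x ∂P, ∀ᶠ N : ℕ in atTop, -W.logRatio P N x ≤ δ * N := by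
  have hδ4 : 0 < δ / 4 := by linarith
  obtain ⟨B, hB, E, hE, hI, h⟩ := W.exists_neg_logRatio_le hP hδ4
  rw [← lintegral_tsum fun N => (hE N).aemeasurable] at hI
  have hfin := ae_lt_top (Measurable.tsum hE) hI
  filter_upwards [h, hW, hfin] with x hx hWx hEx
  have h0 := ENNReal.tendsto_atTop_zero_of_tsum_ne_top hEx.ne
  filter_upwards [eventually_mul_le_mul hWx B hδ4, eventually_ge_atTop 1,
    h0.eventually_le_const (ENNReal.ofReal_pos.2 hδ4)] with N h1 h2 h3
  have h4 := hx.2 N h2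
  have h5 := ENNReal.toReal_le_of_le_ofReal hδ4.le h3
  have h6 : δ / 4 * 1 ≤ δ / 4 * N := by
    gcongr
    exact_mod_cast h2
  have h7 : 0 ≤ δ * N := by positivity
  linarith

theorem Parsing.ae_tendsto_logRatio_div (hP : MeasurePreserving shift P P) (W : Parsing A)
    (hW : ∀ᵐ x ∂P, Tendsto (fun N : ℕ => (W.c N x : ℝ) / (N : ℝ)) atTop (𝓝 0)) :
    ∀ᵐ x ∂P, Tendsto (fun N : ℕ => W.logRatio P N x / (N : ℝ)) atTop (𝓝 0) := by
  have h1 := ae_all_iff.2 fun m : ℕ =>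
    W.ae_eventually_logRatio_le hP hW (Nat.one_div_pos_of_nat (α := ℝ) (n := m))
  have h2 := ae_all_iff.2 fun m : ℕ =>
    W.ae_eventually_neg_logRatio_le hP hW (Nat.one_div_pos_of_nat (α := ℝ) (n := m))
  filter_upwards [h1, h2] with x hx1 hx2
  rw [Metric.tendsto_atTop']
  intro ε hε
  obtain ⟨m, hm⟩ := exists_nat_one_div_lt hε
  obtain ⟨N, hN⟩ := eventually_atTop.1
    (((hx1 m).and (hx2 m)).and (eventually_gt_atTop 0))
  refine ⟨N, fun n hn => ?_⟩
  obtain ⟨⟨h3, h4⟩, h5⟩ := hN n hn.le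
  have h6 : (0 : ℝ) < n := by exact_mod_cast h5
  rw [Real.dist_eq, sub_zero, abs_div, abs_of_pos h6]
  refine lt_of_le_of_lt ?_ hm
  rw [div_le_iff₀ h6]
  exact abs_le'.2 ⟨h3, h4⟩

theorem Parsing.integrable_c (W : Parsing A) (P : Measure (ℕ → A)) [IsProbabilityMeasure P]
    {N : ℕ} (hN : 1 ≤ N) : Integrable (fun x => (W.c N x : ℝ)) P := by
  refine Integrable.of_bound (measurable_from_top.comp (W.measurable_c N hN)).aestronglyMeasurable
    (N : ℝ) (ae_of_all _ fun x => ?_)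
  rw [Real.norm_natCast]
  exact_mod_cast W.c_le N hN x

theorem Parsing.tendsto_integral_c_div (W : Parsing A)
    (hW : ∀ᵐ x ∂P, Tendsto (fun N : ℕ => (W.c N x : ℝ) / (N : ℝ)) atTop (𝓝 0)) :
    Tendsto (fun N : ℕ => (∫ x, (W.c N x : ℝ) ∂P) / N) atTop (𝓝 0) := by
  -- The bound c_N ≤ N dominates by 1; the index is moved by one because nothing is known about c_0.
  have h : Tendsto (fun N : ℕ => ∫ x, (W.c (N + 1) x : ℝ) / ((N + 1 : ℕ) : ℝ) ∂P) atTop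
      (𝓝 (∫ _, (0 : ℝ) ∂P)) := by
    refine tendsto_integral_of_dominated_convergence (fun _ => 1) (fun N => ?_)
      (integrable_const 1) (fun N => ae_of_all _ fun x => ?_) ?_
    · exact ((W.integrable_c P (Nat.le_add_left 1 N)).div_const _).aestronglyMeasurable
    · rw [Real.norm_of_nonneg (by positivity)]
      refine div_le_one_of_le₀ ?_ (by positivity)
      exact_mod_cast W.c_le _ (Nat.le_add_left 1 N) x
    · filter_upwards [hW] with x hx
      exact (tendsto_add_atTop_iff_nat (f := fun N : ℕ => (W.c N x : ℝ) / (N : ℝ)) 1).2 hx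
  simp only [integral_div, integral_zero] at h
  exact (tendsto_add_atTop_iff_nat (f := fun N : ℕ => (∫ x, (W.c N x : ℝ) ∂P) / (N : ℝ)) 1).1 h

/-- What matters is that B and C do not depend on N. One ε comes from the linear term and one from
the ergodic sum, whose mean is at most εN by invariance; C is the total mean of all E_N. -/
theorem Parsing.integrable_logRatio_and_integral_le (hP : MeasurePreserving shift P P)
    (W : Parsing A) {ε : ℝ} (hε : 0 < ε) :
    ∃ B C : ℝ, ∀ N : ℕ, 1 ≤ N → Integrable (W.logRatio P N) P ∧
      ∫ x, |W.logRatio P N x| ∂P ≤ 2 * ε * N + B * ∫ x, (W.c N x : ℝ) ∂P + C := by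
  obtain ⟨B₁, hB₁, H, hH, hHI, h₁⟩ := W.exists_logRatio_le hP hε
  obtain ⟨B₂, hB₂, E, hE, hEI, h₂⟩ := W.exists_neg_logRatio_le hP hε
  refine ⟨B₁ + B₂, (∑' N, ∫⁻ x, E N x ∂P).toReal, fun N hN => ?_⟩
  have hHi : Integrable (fun x => (H x).toReal) P := integrable_toReal_of_lintegral_ne_top
    hH.aemeasurable (ne_top_of_le_ne_top ENNReal.ofReal_ne_top hHI)
  have hHj : ∀ j, Integrable (fun x => (H (shift^[j] x)).toReal) P := fun j =>
    (hP.iterate j).integrable_comp_of_integrable hHi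
  have hHint : ∀ j, ∫ x, (H (shift^[j] x)).toReal ∂P ≤ ε := fun j => by
    have hm : Measurable fun x => H (shift^[j] x) := hH.comp (hP.iterate j).measurable
    rw [integral_toReal hm.aemeasurable]
    · rw [(hP.iterate j).lintegral_comp hH]
      exact ENNReal.toReal_le_of_le_ofReal hε.le hHI
    · exact h₁.mono fun x hx => (hx.1 j).lt_top
  have hEi : Integrable (fun x => (E N x).toReal) P := integrable_toReal_of_lintegral_ne_top
    (hE N).aemeasurable (ENNReal.ne_top_of_tsum_ne_top hEI N)
  have hEint : ∫ x, (E N x).toReal ∂P ≤ (∑' N, ∫⁻ x, E N x ∂P).toReal := by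
    rw [integral_toReal (hE N).aemeasurable (h₂.mono fun x hx => (hx.1 N).lt_top)]
    exact le_toReal_tsum hEI N
  have hc := W.integrable_c P hN
  have hS : Integrable (fun x => ∑ j ∈ Finset.range N, (H (shift^[j] x)).toReal) P :=
    integrable_finsetSum _ fun j _ => hHj j
  have hbound : ∀ᵐ x ∂P, |W.logRatio P N x| ≤ ε * N + (B₁ + B₂) * W.c N x +
      ∑ j ∈ Finset.range N, (H (shift^[j] x)).toReal + (E N x).toReal := by
    filter_upwards [h₁, h₂] with x hx₁ hx₂
    have a1 := hx₁.2 N hN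
    have a2 := hx₂.2 N hN
    have a3 : 0 ≤ B₁ * W.c N x := by positivity
    have a4 : 0 ≤ B₂ * W.c N x := by positivity
    have a5 : 0 ≤ (E N x).toReal := ENNReal.toReal_nonneg
    have a6 : 0 ≤ ∑ j ∈ Finset.range N, (H (shift^[j] x)).toReal :=
      Finset.sum_nonneg fun j _ => ENNReal.toReal_nonneg
    exact abs_le'.2 ⟨by linarith, by linarith⟩
  have i1 : Integrable (fun x => ε * N + (B₁ + B₂) * W.c N x) P :=
    (integrable_const _).add (hc.const_mul _)
  have hint : Integrable (W.logRatio P N) P :=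
    ((i1.add hS).add hEi).mono' (W.measurable_logRatio P N).aestronglyMeasurable hbound
  refine ⟨hint, (integral_mono_ae hint.abs ((i1.add hS).add hEi) hbound).trans ?_⟩
  have e1 : ∫ x, ((fun x => ε * N + (B₁ + B₂) * (W.c N x : ℝ)) +
      (fun x => ∑ j ∈ Finset.range N, (H (shift^[j] x)).toReal) +
        fun x => (E N x).toReal) x ∂P = ε * N + (B₁ + B₂) * ∫ x, (W.c N x : ℝ) ∂P +
      ∑ j ∈ Finset.range N, ∫ x, (H (shift^[j] x)).toReal ∂P + ∫ x, (E N x).toReal ∂P := by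
    rw [integral_add' (i1.add hS) hEi, integral_add' i1 hS,
      integral_add (integrable_const _) (hc.const_mul _), integral_const,
      integral_const_mul, integral_finsetSum _ fun j _ => hHj j]
    simp
  rw [e1]
  have e2 : ∑ j ∈ Finset.range N, ∫ x, (H (shift^[j] x)).toReal ∂P ≤ ε * N := by
    refine (Finset.sum_le_sum fun j _ => hHint j).trans ?_
    simp [mul_comm]
  linarith

theorem Parsing.integrable_logRatio (hP : MeasurePreserving shift P P) (W : Parsing A) (N : ℕ) :
    Integrable (W.logRatio P N) P := by
  rcases Nat.eq_zero_or_pos N with rfl | hN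
  · exact integrable_const (0 : ℝ)
  · obtain ⟨B, C, h⟩ := W.integrable_logRatio_and_integral_le hP one_pos
    exact (h N hN).1

theorem Parsing.tendsto_integral_abs_logRatio_div (hP : MeasurePreserving shift P P)
    (W : Parsing A)
    (hW : ∀ᵐ x ∂P, Tendsto (fun N : ℕ => (W.c N x : ℝ) / (N : ℝ)) atTop (𝓝 0)) :
    Tendsto (fun N : ℕ => ∫ x, |W.logRatio P N x / (N : ℝ)| ∂P) atTop (𝓝 0) := by
  rw [Metric.tendsto_atTop']
  intro ε hε
  obtain ⟨B, C, h⟩ := W.integrable_logRatio_and_integral_le hP (show 0 < ε / 4 by linarith)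
  have h1 : Tendsto (fun N : ℕ => 2 * (ε / 4) + B * ((∫ x, (W.c N x : ℝ) ∂P) / N) + C / N) atTop
      (𝓝 (2 * (ε / 4) + B * 0 + 0)) :=
    (tendsto_const_nhds.add ((W.tendsto_integral_c_div hW).const_mul B)).add
      (tendsto_const_div_atTop_nhds_zero_nat C)
  obtain ⟨N, hN⟩ := eventually_atTop.1
    ((h1.eventually_lt_const (show 2 * (ε / 4) + B * 0 + 0 < ε by linarith)).and
      (eventually_ge_atTop 1))
  refine ⟨N, fun n hn => ?_⟩
  obtain ⟨h2, h3⟩ := hN n hn.le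
  have h4 : (0 : ℝ) < n := by exact_mod_cast h3
  have h5 : ∫ x, |W.logRatio P n x / (n : ℝ)| ∂P = (∫ x, |W.logRatio P n x| ∂P) / n := by
    simp only [abs_div, abs_of_pos h4, integral_div]
  rw [Real.dist_eq, sub_zero, abs_of_nonneg (integral_nonneg fun x => abs_nonneg _), h5]
  refine lt_of_le_of_lt ((div_le_div_of_nonneg_right (h n h3).2 h4.le).trans_eq ?_) h2
  field_simp

end Parsings

end ShiftSpace

theorem mainTheorem2 {A : Type*} [Finite A] [MeasurableSpace A] [MeasurableSingletonClass A]
    (P : Measure (ℕ → A)) [IsProbabilityMeasure P]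
    (hP : MeasurePreserving ShiftSpace.shift P P)
    (W : ShiftSpace.Parsing A)
    (hW : ∀ᵐ x ∂P, Tendsto (fun N : ℕ => (W.c N x : ℝ) / (N : ℝ)) atTop (𝓝 0)) :
    ∃ r : ℕ → (ℕ → A) → ℝ,
      (∀ N, Measurable (r N)) ∧
      (∀ᵐ x ∂P, Tendsto (fun N : ℕ => r N x / (N : ℝ)) atTop (𝓝 0)) ∧
      (∀ N, Integrable (r N) P) ∧
      Tendsto (fun N : ℕ => ∫ x, |r N x / (N : ℝ)| ∂P) atTop (𝓝 0) ∧
      (∀ N, 1 ≤ N → ∀ x, 0 < P.real (ShiftSpace.cyl (ShiftSpace.prefixWord x N)) →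
        P.real (ShiftSpace.cyl (ShiftSpace.prefixWord x N)) =
          (∏ i ∈ Finset.range (W.c N x), P.real (ShiftSpace.cyl (W.block N i x))) *
            Real.exp (r N x)) ∧
      (∀ᵐ x ∂P, ∀ N, 1 ≤ N →
        P.real (ShiftSpace.cyl (ShiftSpace.prefixWord x N)) =
          (∏ i ∈ Finset.range (W.c N x), P.real (ShiftSpace.cyl (W.block N i x))) *
            Real.exp (r N x)) := by
  have := Fintype.ofFinite A
  refine ⟨W.logRatio P, W.measurable_logRatio P, W.ae_tendsto_logRatio_div hP hW,
    W.integrable_logRatio hP, W.tendsto_integral_abs_logRatio_div hP hW, fun N hN x hx => ?_, ?_⟩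
  · exact W.measureReal_eq_prod_mul_exp hP hN (ENNReal.toReal_pos_iff.1 hx).1.ne'
  · filter_upwards [ShiftSpace.ae_measure_cyl_prefixWord_ne_zero P] with x hx N hN
    exact W.measureReal_eq_prod_mul_exp hP hN (hx N)
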